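/- Let $s\ge 0$ be a fixed integer. For a finite set $A\subset\mathbb R^2$ let $Z_{=s}(A)$ and $Z_{\le s}(A)$ be the numbers of (non-degenerate) triangles with vertices in $A$ that contain exactly $s$, respectively at most $s$, points of $A$ in their interior. For each $n$ let $U_1,\dots,U_n$ be independent points, each uniformly distributed in the unit square $[0,1]^2$. Then $$\lim_{n\to\infty}\frac{\mathbb E\,[Z_{=s}(\{U_1,\dots,U_n\})]}{n^2}=2 \qquad\text{and}\qquad \lim_{n\to\infty}\frac{\mathbb E\,[Z_{\le s}(\{U_1,\dots,U_n\})]}{n^2}=2(s+1).$$ Moreover, let $c\ge 1$ be a fixed integer, give each point $U_i$ a colour $\phi_i$ chosen uniformly from $\{1,\dots,c\}$, where the colours are independent of each other and of the points, and let $X^{(c)}_{\le s}$ be the number of triangles with vertices among $U_1,\dots,U_n$ whose three vertices have the same colour and that contain at most $s$ of the points $U_1,\dots,U_n$ in their interior. Then, as $n\to\infty$, $$\mathbb E\,[X^{(c)}_{\le s}]=\frac{2(s+1)}{c^2}\,n^2\,(1+o(1)).$$ -/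

import Mathlib

open MeasureTheory ProbabilityTheory Filter Topology Asymptotics
open scoped ENNReal

/-- The Euclidean plane. -/
abbrev Plane : Type := EuclideanSpace ℝ (Fin 2)

/-- The unit square `[0, 1]²`. -/
def unitSquare : Set Plane := {x | ∀ i, x i ∈ Set.Icc (0 : ℝ) 1}

/-- The number of points of `A` in the (topological) interior of the convex hull of `T`. -/
noncomputable def interiorCount (A T : Set Plane) : ℕ :=
  (interior (convexHull ℝ T) ∩ A).ncard

open scoped Classical in
/-- The (nondegenerate) triangles with vertices in `A`, each given by its set of vertices. -/
noncomputable def trianglesOf (A : Finset Plane) : Finset (Finset Plane) :=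
  (A.powersetCard 3).filter fun T : Finset Plane => AffineIndependent ℝ (fun x : T => (x : Plane))

/-- The number of triangles with vertices in `A` that contain exactly `s` points of `A` in their
interior. -/
noncomputable def numTrianglesEq (s : ℕ) (A : Finset Plane) : ℕ :=
  ((trianglesOf A).filter fun T : Finset Plane => interiorCount A T = s).card

/-- The number of triangles with vertices in `A` that contain at most `s` points of `A` in their
interior. -/
noncomputable def numTrianglesLE (s : ℕ) (A : Finset Plane) : ℕ :=
  ((trianglesOf A).filter fun T : Finset Plane => interiorCount A T ≤ s).card

open scoped Classical in
/-- The finite set `{p 0, …, p (n - 1)}`. -/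
noncomputable def pointSet {n : ℕ} (p : Fin n → Plane) : Finset Plane :=
  Finset.univ.image p

open scoped Classical in
/-- The number of monochromatic triangles with at most `s` interior points in the set
`{p 0, …, p (n - 1)}`, where the point `p i` has the colour `φ i`: the number of index sets
`{i, j, k}` with `i < j < k` such that `p i, p j, p k` are the vertices of a triangle, have the same
colour, and at most `s` of the points lie in the interior of this triangle. -/
noncomputable def numMonoTrianglesLE {n c : ℕ} (s : ℕ) (p : Fin n → Plane) (φ : Fin n → Fin c) :
    ℕ :=
  (((Finset.univ : Finset (Fin n)).powersetCard 3).filter fun I : Finset (Fin n) =>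
    AffineIndependent ℝ (fun i : I => p i) ∧
    interiorCount (pointSet p) (p '' I) ≤ s ∧
    ∀ i ∈ I, ∀ j ∈ I, φ i = φ j).card

/-- `U i`, `i < n`, are independent points, each uniformly distributed in the unit square. -/
def IsUniformSample {Ω : Type*} [MeasurableSpace Ω] (μ : Measure Ω) {n : ℕ}
    (U : Fin n → Ω → Plane) : Prop :=
  iIndepFun U μ ∧ ∀ i, pdf.IsUniform (U i) unitSquare μ volume

/-- `φ` is a uniformly random `c`-colouring of the random points `U i`, `i < n`: the colours are
independent of the points and of each other, and each is uniform on the `c` colours. -/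
def IsUniformColoring {Ω : Type*} [MeasurableSpace Ω] (μ : Measure Ω) {n c : ℕ}
    (U : Fin n → Ω → Plane) (φ : Fin n → Ω → Fin c) : Prop :=
  iIndepFun φ μ ∧ (∀ i, AEMeasurable (φ i) μ) ∧
  (∀ i a, μ {ω | φ i ω = a} = (c : ℝ≥0∞)⁻¹) ∧
  IndepFun (fun ω i => U i ω) (fun ω i => φ i ω) μ

/-!
A triple of the `n` random points spans a triangle of random area `A`. As the square is convex and
has area `1`, given the vertices each other point falls into the triangle with probability `A`
(`squareMeasure_openTriangle`), so the number of interior points is binomial with parameters `n - 3`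
and `A` (`measureReal_fewInside`), and the expected number of triangles with at most `s` interior
points is `C(n, 3) · E P(Bin(n - 3, A) ≤ s)`. Only small areas matter, and everything follows from

* `tendsto_areaLaw_Iio_div`: `P(A < t) ~ 12 t` as `t → 0`;
* `tendsto_mul_integral_binomialCdf`: if `P(A < t) ~ κ t`, then `n · E P(Bin(n, A) ≤ s) → κ (s + 1)`.

Since `12 / 6 = 2`, this gives `2 (s + 1) n²` triangles. The count for exactly `s` is the difference
of two such counts, and an independent colouring makes a given triple monochromatic with probability
`c⁻²`.

For the first fact, let the third point `(x, y)` be the one with the middle first coordinate, which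
by symmetry costs a factor `3`. Twice the area is `|q₀ - p₀| · |y - ℓ|`, where `ℓ` is the height at
`x` of the line through the first two points `p`, `q`. Because `x` is between `p₀` and `q₀`, the
height `ℓ` is almost surely in `(0, 1)`, so for small `t` the admissible `y` form an interval of length exactly
`4 t / |q₀ - p₀|`, and never a longer one. By dominated convergence the probability divided by `t`
tends to the integral of `4 / |q₀ - p₀|` over all `x` between `p₀` and `q₀`, which is `4`, whatever
`p` and `q` are.

For the second fact, `a ↦ P(Bin(n + 1, a) ≤ s)` has derivative `-(n + 1) b_{n,s}(a)` with a Bernstein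
polynomial `b_{n,s}`, so that the mean is the integral of this kernel against the distribution
function `F` of `A`. One replaces `F t` by `κ t` up to an error `ε t + K t²`; the first two moments of
the kernel are explicit.
-/

/-! ### Binomial distribution functions and an Abelian theorem -/

/-- The polynomial `∑ k ≤ s, C(n, k) Xᵏ (1 - X)ⁿ⁻ᵏ`; its value at `a ∈ [0, 1]` is the probability
that a binomial random variable with parameters `n` and `a` is at most `s`. -/
noncomputable def binomialCdf (n s : ℕ) : Polynomial ℝ :=
  ∑ k ∈ Finset.range (s + 1), bernsteinPolynomial ℝ n k

lemma derivative_binomialCdf (n s : ℕ) :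
    Polynomial.derivative (binomialCdf (n + 1) s) = -((n + 1) * bernsteinPolynomial ℝ n s) := by
  induction s with
  | zero =>
    simp only [binomialCdf, zero_add, Finset.sum_range_one, bernsteinPolynomial.derivative_zero,
      Nat.add_sub_cancel]
    push_cast
    ring
  | succ s ih =>
    have h : binomialCdf (n + 1) (s + 1)
        = binomialCdf (n + 1) s + bernsteinPolynomial ℝ (n + 1) (s + 1) := by
      simp [binomialCdf, Finset.sum_range_succ]
    rw [h, Polynomial.derivative_add, ih, bernsteinPolynomial.derivative_succ]
    push_cast
    ring

lemma eval_binomialCdf_one {n s : ℕ} (h : s < n) : (binomialCdf n s).eval 1 = 0 := by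
  rw [binomialCdf, Polynomial.eval_finsetSum]
  refine Finset.sum_eq_zero fun k hk => ?_
  rw [bernsteinPolynomial.eval_at_1, if_neg]
  have := Finset.mem_range.1 hk
  omega

lemma eval_binomialCdf_zero (n s : ℕ) : (binomialCdf n s).eval 0 = 1 := by
  simp [binomialCdf, Polynomial.eval_finsetSum, bernsteinPolynomial.eval_at_0]

lemma eval_binomialCdf_eq_integral {n s : ℕ} (h : s ≤ n) (a : ℝ) :
    (binomialCdf (n + 1) s).eval a
      = ∫ t in a..1, ((n : ℝ) + 1) * (bernsteinPolynomial ℝ n s).eval t := by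
  have key := intervalIntegral.integral_eq_sub_of_hasDerivAt
    (f := fun t => (binomialCdf (n + 1) s).eval t)
    (f' := fun t => -(((n : ℝ) + 1) * (bernsteinPolynomial ℝ n s).eval t)) (a := a) (b := 1)
    (fun t _ => by
      have := (binomialCdf (n + 1) s).hasDerivAt t
      rw [derivative_binomialCdf] at this
      simpa using this)
    (by
      apply Continuous.intervalIntegrable
      fun_prop)
  rw [intervalIntegral.integral_neg, eval_binomialCdf_one (by omega)] at key
  linarith

lemma integral_bernsteinPolynomial {n k : ℕ} (h : k ≤ n) :
    ∫ t in (0 : ℝ)..1, (bernsteinPolynomial ℝ n k).eval t = 1 / ((n : ℝ) + 1) := by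
  have := eval_binomialCdf_eq_integral h 0
  rw [eval_binomialCdf_zero, intervalIntegral.integral_const_mul] at this
  have hn : (n : ℝ) + 1 ≠ 0 := by positivity
  field_simp
  linarith

lemma mul_bernsteinPolynomial_eval (n k : ℕ) (t : ℝ) :
    ((n : ℝ) + 1) * (t * (bernsteinPolynomial ℝ n k).eval t)
      = ((k : ℝ) + 1) * (bernsteinPolynomial ℝ (n + 1) (k + 1)).eval t := by
  have h : ((n : ℝ) + 1) * (n.choose k : ℝ) = ((n + 1).choose (k + 1) : ℝ) * ((k : ℝ) + 1) := by
    exact_mod_cast Nat.add_one_mul_choose_eq n k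
  simp only [bernsteinPolynomial, Polynomial.eval_mul, Polynomial.eval_pow, Polynomial.eval_sub,
    Polynomial.eval_X, Polynomial.eval_one, Polynomial.eval_natCast, Nat.add_sub_add_right]
  linear_combination t ^ (k + 1) * (1 - t) ^ (n - k) * h

lemma bernsteinPolynomial_eval_nonneg (n k : ℕ) {t : ℝ} (h0 : 0 ≤ t) (h1 : t ≤ 1) :
    0 ≤ (bernsteinPolynomial ℝ n k).eval t := by
  have : 0 ≤ 1 - t := by linarith
  simp only [bernsteinPolynomial, Polynomial.eval_mul, Polynomial.eval_pow, Polynomial.eval_sub,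
    Polynomial.eval_X, Polynomial.eval_one, Polynomial.eval_natCast]
  positivity

/-- The kernel `(n + 1) b_{n,s}`, which is minus the derivative of `binomialCdf (n + 1) s`, has
first moment `(s + 1) / (n + 2)`. -/
lemma integral_mul_bernsteinPolynomial {n s : ℕ} (h : s ≤ n) :
    ∫ t in (0 : ℝ)..1, (((n : ℝ) + 1) * (bernsteinPolynomial ℝ n s).eval t) * t
      = ((s : ℝ) + 1) / ((n : ℝ) + 2) := by
  have : ∀ t : ℝ, (((n : ℝ) + 1) * (bernsteinPolynomial ℝ n s).eval t) * t
      = ((s : ℝ) + 1) * (bernsteinPolynomial ℝ (n + 1) (s + 1)).eval t := fun t => by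
    rw [← mul_bernsteinPolynomial_eval]; ring
  simp_rw [this]
  rw [intervalIntegral.integral_const_mul, integral_bernsteinPolynomial (by omega)]
  push_cast
  ring

lemma integral_sq_mul_bernsteinPolynomial {n s : ℕ} (h : s ≤ n) :
    ∫ t in (0 : ℝ)..1, (((n : ℝ) + 1) * (bernsteinPolynomial ℝ n s).eval t) * t ^ 2
      = ((s : ℝ) + 1) * ((s : ℝ) + 2) / (((n : ℝ) + 2) * ((n : ℝ) + 3)) := by
  have : ∀ t : ℝ, (((n : ℝ) + 1) * (bernsteinPolynomial ℝ n s).eval t) * t ^ 2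
      = ((s : ℝ) + 1) * ((s : ℝ) + 2) / ((n : ℝ) + 2)
        * (bernsteinPolynomial ℝ (n + 2) (s + 2)).eval t := fun t => by
    have h1 := mul_bernsteinPolynomial_eval n s t
    have h2 := mul_bernsteinPolynomial_eval (n + 1) (s + 1) t
    push_cast at h2
    have hn : (n : ℝ) + 2 ≠ 0 := by positivity
    field_simp
    linear_combination t * ((n : ℝ) + 2) * h1 + ((s : ℝ) + 1) * h2
  simp_rw [this]
  rw [intervalIntegral.integral_const_mul, integral_bernsteinPolynomial (by omega)]
  push_cast
  field_simp
  ring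

/-- Integration by parts: the mean of `binomialCdf` under a law on `[0, 1]`, in terms of the
distribution function of this law. -/
lemma integral_binomialCdf_eq {m : Measure ℝ} [IsProbabilityMeasure m]
    (hm : ∀ᵐ a ∂m, a ∈ Set.Icc (0 : ℝ) 1) {n s : ℕ} (h : s ≤ n) :
    ∫ a, (binomialCdf (n + 1) s).eval a ∂m
      = ∫ t in (0 : ℝ)..1,
          (((n : ℝ) + 1) * (bernsteinPolynomial ℝ n s).eval t) * m.real (Set.Iio t) := by
  set w : ℝ → ℝ := fun t => ((n : ℝ) + 1) * (bernsteinPolynomial ℝ n s).eval t with hw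
  have hwc : Continuous w := by fun_prop
  have hwi : Integrable w (volume.restrict (Set.Ioc (0 : ℝ) 1)) :=
    (hwc.intervalIntegrable 0 1).1
  have hS : MeasurableSet {q : ℝ × ℝ | q.1 < q.2} := measurableSet_lt measurable_fst measurable_snd
  have h1 : ∫ a, (binomialCdf (n + 1) s).eval a ∂m
      = ∫ a, (∫ t in Set.Ioc (0 : ℝ) 1,
          {q : ℝ × ℝ | q.1 < q.2}.indicator (fun q => w q.2) (a, t)) ∂m := by
    refine integral_congr_ae ?_
    filter_upwards [hm] with a ha
    rw [eval_binomialCdf_eq_integral h, intervalIntegral.integral_of_le ha.2]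
    have : ∀ t, {q : ℝ × ℝ | q.1 < q.2}.indicator (fun q => w q.2) (a, t)
        = (Set.Ioi a).indicator w t := fun t => by
      simp [Set.indicator_apply]
    simp_rw [this]
    rw [setIntegral_indicator measurableSet_Ioi, Set.Ioc_inter_Ioi, max_eq_right ha.1]
  rw [h1, integral_integral_swap, intervalIntegral.integral_of_le zero_le_one]
  · refine integral_congr_ae (ae_of_all _ fun t => ?_)
    have : ∀ a, {q : ℝ × ℝ | q.1 < q.2}.indicator (fun q => w q.2) (a, t)
        = (Set.Iio t).indicator (fun _ => w t) a := fun a => by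
      simp [Set.indicator_apply]
    simp only [this]
    rw [integral_indicator_const _ measurableSet_Iio, smul_eq_mul, mul_comm]
  · have : Integrable (fun q : ℝ × ℝ => w q.2) (m.prod (volume.restrict (Set.Ioc (0 : ℝ) 1))) :=
      hwi.comp_snd m
    exact this.indicator hS

/-- If `F t ~ κ t` as `t → 0+` and `F` is bounded, then `F t - κ t` is at most `ε t + K t²` on all
of `(0, 1]`. -/
lemma exists_abs_sub_le_of_tendsto_div {F : ℝ → ℝ} {κ : ℝ} (hF : ∀ t, |F t| ≤ 1)
    (hlim : Tendsto (fun t => F t / t) (𝓝[>] 0) (𝓝 κ)) {ε : ℝ} (hε : 0 < ε) :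
    ∃ K, 0 ≤ K ∧ ∀ t ∈ Set.Ioc (0 : ℝ) 1, |F t - κ * t| ≤ ε * t + K * t ^ 2 := by
  have h1 : ∀ᶠ t in 𝓝[>] (0 : ℝ), |F t / t - κ| < ε := by
    simpa [Real.dist_eq] using (Metric.tendsto_nhds.1 hlim) ε hε
  obtain ⟨δ, hδ, hδs⟩ := mem_nhdsGT_iff_exists_Ioo_subset.1 h1
  have hδ0 : (0 : ℝ) < δ := hδ
  refine ⟨(1 + |κ|) / δ ^ 2, by positivity, fun t ht => ?_⟩
  by_cases htδ : t < δ
  · have h2 : |F t / t - κ| < ε := hδs ⟨ht.1, htδ⟩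
    have h3 : F t - κ * t = (F t / t - κ) * t := by
      have := ht.1.ne'
      field_simp
    rw [h3, abs_mul, abs_of_pos ht.1]
    have := ht.1
    have : |F t / t - κ| * t ≤ ε * t := by gcongr
    have : 0 ≤ (1 + |κ|) / δ ^ 2 * t ^ 2 := by positivity
    linarith
  · push Not at htδ
    have h2 : |F t - κ * t| ≤ 1 + |κ| := by
      refine (abs_sub _ _).trans (add_le_add (hF t) ?_)
      rw [abs_mul, abs_of_pos ht.1]
      exact mul_le_of_le_one_right (abs_nonneg _) ht.2
    have h3 : (1 : ℝ) ≤ t ^ 2 / δ ^ 2 := by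
      rw [le_div_iff₀ (by positivity)]
      nlinarith
    have h4 : (1 + |κ|) / δ ^ 2 * t ^ 2 = (1 + |κ|) * (t ^ 2 / δ ^ 2) := by ring
    have h5 : 1 + |κ| ≤ (1 + |κ|) * (t ^ 2 / δ ^ 2) :=
      le_mul_of_one_le_right (by positivity) h3
    have := mul_pos hε ht.1
    linarith

/-- An Abelian theorem: if a law on `[0, 1]` has distribution function `~ κ t` at `0`, then its
mixture of binomial laws with parameter `n` is at most `s` with probability `~ κ (s + 1) / n`. -/
theorem tendsto_mul_integral_binomialCdf {m : Measure ℝ} [IsProbabilityMeasure m]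
    (hm : ∀ᵐ a ∂m, a ∈ Set.Icc (0 : ℝ) 1) {κ : ℝ}
    (hlim : Tendsto (fun t => m.real (Set.Iio t) / t) (𝓝[>] 0) (𝓝 κ)) (s : ℕ) :
    Tendsto (fun n : ℕ => (n : ℝ) * ∫ a, (binomialCdf n s).eval a ∂m) atTop
      (𝓝 (κ * ((s : ℝ) + 1))) := by
  have hF : ∀ t, |m.real (Set.Iio t)| ≤ 1 := fun t => by
    rw [abs_of_nonneg measureReal_nonneg]; exact measureReal_le_one
  have hFm : Monotone fun t => m.real (Set.Iio t) := fun t u htu =>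
    measureReal_mono (Set.Iio_subset_Iio htu)
  -- The error of replacing the distribution function by `κ t`.
  have herr : ∀ ε > 0, ∃ K, 0 ≤ K ∧ ∀ n : ℕ, s ≤ n →
      |∫ a, (binomialCdf (n + 1) s).eval a ∂m - κ * (((s : ℝ) + 1) / ((n : ℝ) + 2))|
        ≤ ε * (((s : ℝ) + 1) / ((n : ℝ) + 2))
          + K * (((s : ℝ) + 1) * ((s : ℝ) + 2) / (((n : ℝ) + 2) * ((n : ℝ) + 3))) := by
    intro ε hε
    obtain ⟨K, hK0, hK⟩ := exists_abs_sub_le_of_tendsto_div hF hlim hε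
    refine ⟨K, hK0, fun n hn => ?_⟩
    rw [integral_binomialCdf_eq hm hn, ← integral_mul_bernsteinPolynomial hn,
      ← integral_sq_mul_bernsteinPolynomial hn]
    set w : ℝ → ℝ := fun t => ((n : ℝ) + 1) * (bernsteinPolynomial ℝ n s).eval t with hw
    have hwc : Continuous w := by fun_prop
    have hi1 : IntervalIntegrable (fun t => w t * t) volume 0 1 :=
      (by fun_prop : Continuous fun t => w t * t).intervalIntegrable _ _
    have hi2 : IntervalIntegrable (fun t => w t * t ^ 2) volume 0 1 :=
      (by fun_prop : Continuous fun t => w t * t ^ 2).intervalIntegrable _ _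
    have hi3 : IntervalIntegrable (fun t => w t * m.real (Set.Iio t)) volume 0 1 :=
      (hFm.intervalIntegrable).continuousOn_mul hwc.continuousOn
    rw [← intervalIntegral.integral_const_mul, ← intervalIntegral.integral_const_mul,
      ← intervalIntegral.integral_const_mul, ← intervalIntegral.integral_sub hi3 (hi1.const_mul _),
      ← intervalIntegral.integral_add (hi1.const_mul _) (hi2.const_mul _), ← Real.norm_eq_abs]
    refine intervalIntegral.norm_integral_le_of_norm_le zero_le_one (ae_of_all _ fun t ht => ?_)
      ((hi1.const_mul _).add (hi2.const_mul _))
    have hw0 : 0 ≤ w t := by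
      have := bernsteinPolynomial_eval_nonneg n s ht.1.le ht.2
      simp only [hw]
      positivity
    have h1 : w t * m.real (Set.Iio t) - κ * (w t * t) = w t * (m.real (Set.Iio t) - κ * t) := by
      ring
    have h2 : ε * (w t * t) + K * (w t * t ^ 2) = w t * (ε * t + K * t ^ 2) := by ring
    rw [h1, h2, Real.norm_eq_abs, abs_mul, abs_of_nonneg hw0]
    exact mul_le_mul_of_nonneg_left (hK t ht) hw0
  have hzero : ∀ c : ℝ, Tendsto (fun n : ℕ => c / ((n : ℝ) + 3)) atTop (𝓝 0) := fun c =>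
    tendsto_const_nhds.div_atTop
      (tendsto_atTop_add_const_right _ _ tendsto_natCast_atTop_atTop)
  rw [← tendsto_add_atTop_iff_nat 1]
  rw [Metric.tendsto_atTop]
  intro η hη
  have hs : (0 : ℝ) < (s : ℝ) + 1 := by positivity
  obtain ⟨K, hK0, hK⟩ := herr (η / 2 / (s + 1)) (by positivity)
  -- Beyond `η / 2`, all the errors are `O(1 / n)`, with the following constant.
  obtain ⟨n₀, hn₀⟩ := eventually_atTop.1 ((hzero
    (K * (((s : ℝ) + 1) * ((s : ℝ) + 2)) + 3 * (|κ| * ((s : ℝ) + 1)))).eventually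
      (gt_mem_nhds (by positivity : (0 : ℝ) < η / 2)))
  refine ⟨max n₀ s, fun n hn => ?_⟩
  have h1 := hK n (le_trans (le_max_right _ _) hn)
  have h2 := hn₀ n (le_trans (le_max_left _ _) hn)
  set I := ∫ a, (binomialCdf (n + 1) s).eval a ∂m
  rw [Real.dist_eq]
  push_cast
  have hn2 : (0 : ℝ) < (n : ℝ) + 2 := by positivity
  have hn3 : (0 : ℝ) < (n : ℝ) + 3 := by positivity
  have e1 : ((n : ℝ) + 1) * I - κ * ((s : ℝ) + 1)
      = ((n : ℝ) + 1) * (I - κ * (((s : ℝ) + 1) / ((n : ℝ) + 2)))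
        - κ * ((s : ℝ) + 1) / ((n : ℝ) + 2) := by
    field_simp
    ring
  have e2 : |((n : ℝ) + 1) * (I - κ * (((s : ℝ) + 1) / ((n : ℝ) + 2)))|
      ≤ ((n : ℝ) + 2) * (η / 2 / (s + 1) * (((s : ℝ) + 1) / ((n : ℝ) + 2))
          + K * (((s : ℝ) + 1) * ((s : ℝ) + 2) / (((n : ℝ) + 2) * ((n : ℝ) + 3)))) := by
    rw [abs_mul, abs_of_pos (by positivity : (0 : ℝ) < (n : ℝ) + 1)]
    gcongr
    linarith
  have e3 : ((n : ℝ) + 2) * (η / 2 / (s + 1) * (((s : ℝ) + 1) / ((n : ℝ) + 2))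
          + K * (((s : ℝ) + 1) * ((s : ℝ) + 2) / (((n : ℝ) + 2) * ((n : ℝ) + 3))))
      = η / 2 + K * (((s : ℝ) + 1) * ((s : ℝ) + 2)) / ((n : ℝ) + 3) := by
    field_simp
  have e4 : |κ * ((s : ℝ) + 1) / ((n : ℝ) + 2)| ≤ 3 * (|κ| * ((s : ℝ) + 1)) / ((n : ℝ) + 3) := by
    rw [abs_div, abs_mul, abs_of_pos hs, abs_of_pos hn2, div_le_div_iff₀ hn2 hn3]
    have : 0 ≤ |κ| * ((s : ℝ) + 1) := by positivity
    have : (0 : ℝ) ≤ n := by positivity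
    nlinarith
  rw [add_div] at h2
  rw [e1]
  refine (abs_sub _ _).trans_lt ?_
  linarith

/-! ### Triangles in coordinates -/

/-- Twice the signed area of the triangle with vertices `a`, `b`, `c`. -/
def orient (a b c : Plane) : ℝ := (b 0 - a 0) * (c 1 - a 1) - (b 1 - a 1) * (c 0 - a 0)

lemma orient_swap_right (a b c : Plane) : orient a c b = -orient a b c := by
  simp only [orient]; ring

lemma orient_swap_left (a b c : Plane) : orient b a c = -orient a b c := by
  simp only [orient]; ring

/-- The open triangle with vertices `a`, `b`, `c`: the points `x` which lie, for each side, strictly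
on the same side as the opposite vertex. It is empty if `a`, `b`, `c` are collinear. -/
def openTriangle (a b c : Plane) : Set Plane :=
  {x | 0 < orient x b c * orient a b c ∧ 0 < orient a x c * orient a b c ∧
    0 < orient a b x * orient a b c}

lemma affineIndependent_iff_orient_ne_zero (p : Fin 3 → Plane) :
    AffineIndependent ℝ p ↔ orient (p 0) (p 1) (p 2) ≠ 0 := by
  rw [affineIndependent_iff_linearIndependent_vsub ℝ _ (0 : Fin 3)]
  have e : LinearIndependent ℝ (fun i : {x : Fin 3 // x ≠ 0} => (p i -ᵥ p 0 : Plane)) ↔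
      LinearIndependent ℝ ![p 1 - p 0, p 2 - p 0] := by
    rw [← linearIndependent_equiv (finSuccAboveEquiv (0 : Fin 3))]
    congr! 1
    ext i j
    fin_cases i <;> simp [finSuccAboveEquiv]
  rw [e, LinearIndependent.pair_iff]
  constructor
  · intro h h0
    simp only [orient] at h0
    -- If the determinant vanishes, its cofactors give a linear relation.
    have h1 := h (p 2 0 - p 0 0) (-(p 1 0 - p 0 0)) (by
      ext i; fin_cases i <;> simp <;> linarith)
    have h2 := h (p 2 1 - p 0 1) (-(p 1 1 - p 0 1)) (by
      ext i; fin_cases i <;> simp <;> linarith)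
    have h3 := h 1 0 (by
      ext i; fin_cases i <;> simp <;> linarith [h1.1, h1.2, h2.1, h2.2])
    exact one_ne_zero h3.1
  · intro h u v huv
    have h0 := congrArg (fun x : Plane => x 0) huv
    have h1 := congrArg (fun x : Plane => x 1) huv
    simp at h0 h1
    simp only [orient] at h
    constructor
    · refine (mul_eq_zero.1 (?_ : u * _ = 0)).resolve_right h
      linear_combination (p 2 1 - p 0 1) * h0 - (p 2 0 - p 0 0) * h1
    · refine (mul_eq_zero.1 (?_ : v * _ = 0)).resolve_right h
      linear_combination (p 1 0 - p 0 0) * h1 - (p 1 1 - p 0 1) * h0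

/-- The interior of a nondegenerate triangle is where all barycentric coordinates are positive; these
are quotients of values of `orient`. -/
lemma interior_convexHull_eq_openTriangle {p : Fin 3 → Plane} (h : AffineIndependent ℝ p) :
    interior (convexHull ℝ (Set.range p)) = openTriangle (p 0) (p 1) (p 2) := by
  have htop : affineSpan ℝ (Set.range p) = ⊤ := by
    rw [h.affineSpan_eq_top_iff_card_eq_finrank_add_one]
    simp
  have hD := (affineIndependent_iff_orient_ne_zero p).1 h
  let b : AffineBasis (Fin 3) ℝ Plane := ⟨p, h, htop⟩
  have hb : interior (convexHull ℝ (Set.range p)) = {x | ∀ i, 0 < b.coord i x} :=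
    b.interior_convexHull
  rw [hb]
  ext x
  have hs := b.sum_coord_apply_eq_one x
  have hx := b.linear_combination_coord_eq_self x
  have hx0 := congrArg (fun x : Plane => x 0) hx
  have hx1 := congrArg (fun x : Plane => x 1) hx
  have hbp : ∀ i, b i = p i := fun i => rfl
  simp only [Fin.sum_univ_three, hbp, PiLp.add_apply, PiLp.smul_apply, smul_eq_mul] at hs hx0 hx1
  simp only [openTriangle, Set.mem_ofPred_eq, Fin.forall_fin_succ, Fin.succ_zero_eq_one,
    Fin.succ_one_eq_two, IsEmpty.forall_iff, and_true]
  -- Cramer's rule for the barycentric coordinates.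
  have e0 : orient x (p 1) (p 2) = b.coord 0 x * orient (p 0) (p 1) (p 2) := by
    simp only [orient]
    rw [← hx0, ← hx1]
    have hs' : b.coord 2 x = 1 - b.coord 0 x - b.coord 1 x := by linarith
    rw [hs']; ring
  have e1 : orient (p 0) x (p 2) = b.coord 1 x * orient (p 0) (p 1) (p 2) := by
    simp only [orient]
    rw [← hx0, ← hx1]
    have hs' : b.coord 2 x = 1 - b.coord 0 x - b.coord 1 x := by linarith
    rw [hs']; ring
  have e2 : orient (p 0) (p 1) x = b.coord 2 x * orient (p 0) (p 1) (p 2) := by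
    simp only [orient]
    rw [← hx0, ← hx1]
    have hs' : b.coord 1 x = 1 - b.coord 0 x - b.coord 2 x := by linarith
    rw [hs']; ring
  rw [e0, e1, e2]
  simp only [mul_assoc]
  have hpos : 0 < orient (p 0) (p 1) (p 2) * orient (p 0) (p 1) (p 2) := mul_self_pos.2 hD
  simp only [mul_pos_iff_of_pos_right hpos]

lemma vertices_notMem_openTriangle (a b c : Plane) :
    a ∉ openTriangle a b c ∧ b ∉ openTriangle a b c ∧ c ∉ openTriangle a b c := by
  refine ⟨fun h => ?_, fun h => ?_, fun h => ?_⟩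
  · simpa [orient] using h.2.1
  · simpa [orient] using h.1
  · have := h.1
    simp [orient, mul_comm] at this

lemma measurable_orient {α : Type*} [MeasurableSpace α] {f g h : α → Plane} (hf : Measurable f)
    (hg : Measurable g) (hh : Measurable h) : Measurable fun x => orient (f x) (g x) (h x) := by
  unfold orient
  fun_prop

lemma measurableSet_mem_openTriangle {α : Type*} [MeasurableSpace α] {f g h k : α → Plane}
    (hf : Measurable f) (hg : Measurable g) (hh : Measurable h) (hk : Measurable k) :
    MeasurableSet {x | k x ∈ openTriangle (f x) (g x) (h x)} := by
  have hD := measurable_orient hf hg hh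
  have h1 := (measurable_orient hk hg hh).mul hD
  have h2 := (measurable_orient hf hk hh).mul hD
  have h3 := (measurable_orient hf hg hk).mul hD
  exact (measurableSet_lt measurable_const h1).inter
    ((measurableSet_lt measurable_const h2).inter (measurableSet_lt measurable_const h3))

/-- The open standard triangle has area `1 / 2`. -/
lemma volume_standard_triangle :
    volume {x : Fin 2 → ℝ | 0 < x 0 ∧ 0 < x 1 ∧ x 0 + x 1 < 1} = ENNReal.ofReal (1 / 2) := by
  have h : {x : Fin 2 → ℝ | 0 < x 0 ∧ 0 < x 1 ∧ x 0 + x 1 < 1}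
      = MeasurableEquiv.finTwoArrow ⁻¹'
          regionBetween (fun _ : ℝ => (0 : ℝ)) (fun x => 1 - x) (Set.Ioc 0 1) := by
    ext x
    simp only [Set.mem_ofPred_eq, regionBetween, Set.mem_preimage, MeasurableEquiv.finTwoArrow_apply,
      Set.mem_Ioc, Set.mem_Ioo]
    constructor
    · rintro ⟨h1, h2, h3⟩
      exact ⟨⟨h1, by linarith⟩, h2, by linarith⟩
    · rintro ⟨⟨h1, -⟩, h2, h3⟩
      exact ⟨h1, h2, by linarith⟩
  rw [h, (volume_preserving_finTwoArrow ℝ).measure_preimage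
    (measurableSet_regionBetween measurable_const (by fun_prop) measurableSet_Ioc).nullMeasurableSet,
    Measure.volume_eq_prod,
    volume_regionBetween_eq_integral (f := fun _ => (0 : ℝ)) (g := fun x => 1 - x)
      integrableOn_zero ?_ measurableSet_Ioc ?_]
  · rw [← intervalIntegral.integral_of_le zero_le_one]
    congr 1
    simp only [Pi.sub_apply, sub_zero]
    rw [intervalIntegral.integral_sub (by simp) (by simp)]
    simp
    norm_num
  · exact ((by fun_prop : Continuous fun x : ℝ => 1 - x).intervalIntegrable 0 1).1
  · intro x hx
    have := hx.2
    linarith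

lemma volume_openTriangle (a b c : Plane) :
    volume (openTriangle a b c) = ENNReal.ofReal (|orient a b c| / 2) := by
  by_cases hD : orient a b c = 0
  · simp [openTriangle, hD]
  set S := {x : Fin 2 → ℝ | 0 < x 0 ∧ 0 < x 1 ∧ x 0 + x 1 < 1}
  let M : Matrix (Fin 2) (Fin 2) ℝ := !![b 0 - a 0, c 0 - a 0; b 1 - a 1, c 1 - a 1]
  have hM : M.det = orient a b c := by
    simp only [M, Matrix.det_fin_two_of, orient]; ring
  have hpre : (fun v => WithLp.ofLp a + v) ⁻¹' (WithLp.toLp 2 ⁻¹' openTriangle a b c)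
      = (Matrix.toLin' M) '' S := by
    have hpos : 0 < orient a b c * orient a b c := mul_self_pos.2 hD
    have key : ∀ u : Fin 2 → ℝ, WithLp.toLp 2 (WithLp.ofLp a + M.mulVec u) ∈ openTriangle a b c
        ↔ u ∈ S := by
      intro u
      have e0 : orient (WithLp.toLp 2 (WithLp.ofLp a + M.mulVec u)) b c
          = (1 - u 0 - u 1) * orient a b c := by
        simp [orient, M, dotProduct, Fin.sum_univ_two]; ring
      have e1 : orient a (WithLp.toLp 2 (WithLp.ofLp a + M.mulVec u)) c
          = u 0 * orient a b c := by
        simp [orient, M, dotProduct, Fin.sum_univ_two]; ring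
      have e2 : orient a b (WithLp.toLp 2 (WithLp.ofLp a + M.mulVec u))
          = u 1 * orient a b c := by
        simp [orient, M, dotProduct, Fin.sum_univ_two]; ring
      simp only [openTriangle, Set.mem_ofPred_eq, e0, e1, e2, mul_assoc,
        mul_pos_iff_of_pos_right hpos, S]
      constructor
      · rintro ⟨h1, h2, h3⟩
        exact ⟨h2, h3, by linarith⟩
      · rintro ⟨h1, h2, h3⟩
        exact ⟨by linarith, h1, h2⟩
    ext v
    constructor
    · intro hv
      have hdet : IsUnit M.det := by rw [hM]; exact isUnit_iff_ne_zero.2 hD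
      have hv' : M.mulVec (M⁻¹.mulVec v) = v := by
        rw [Matrix.mulVec_mulVec, Matrix.mul_nonsing_inv _ hdet, Matrix.one_mulVec]
      refine ⟨M⁻¹.mulVec v, (key _).1 ?_, by simpa using hv'⟩
      rw [hv']; exact hv
    · rintro ⟨u, hu, rfl⟩
      exact (key u).2 hu
  have hmeas : MeasurableSet (openTriangle a b c) :=
    measurableSet_mem_openTriangle measurable_const measurable_const measurable_const measurable_id
  rw [← (PiLp.volume_preserving_toLp (Fin 2)).measure_preimage hmeas.nullMeasurableSet,
    ← measure_preimage_add volume (WithLp.ofLp a), hpre, Measure.addHaar_image_linearMap,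
    LinearMap.det_toLin', hM, volume_standard_triangle, ← ENNReal.ofReal_mul (abs_nonneg _)]
  congr 1
  ring

/-! ### The area of a random triangle in the square -/

/-- The uniform distribution on the unit square. -/
noncomputable def squareMeasure : Measure Plane := volume.restrict unitSquare

/-- The uniform distribution on the unit square is the law of two independent uniform
coordinates. -/
lemma measurePreserving_coord_squareMeasure :
    MeasurePreserving (fun p : Plane => (p 0, p 1)) squareMeasure
      ((volume.restrict (Set.Icc (0 : ℝ) 1)).prod (volume.restrict (Set.Icc (0 : ℝ) 1))) := by
  have h1 : MeasurePreserving (fun p : Plane => (p 0, p 1)) volume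
      ((volume : Measure ℝ).prod volume) :=
    (volume_preserving_finTwoArrow ℝ).comp (PiLp.volume_preserving_ofLp (Fin 2))
  have h2 : unitSquare
      = (fun p : Plane => (p 0, p 1)) ⁻¹' (Set.Icc (0 : ℝ) 1 ×ˢ Set.Icc (0 : ℝ) 1) := by
    ext p
    simp only [unitSquare, Fin.forall_fin_two, Set.mem_ofPred_eq, Set.mem_preimage, Set.mem_prod]
  rw [squareMeasure, h2, Measure.prod_restrict]
  exact h1.restrict_preimage (measurableSet_Icc.prod measurableSet_Icc)

lemma measurableSet_unitSquare : MeasurableSet unitSquare := by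
  have : unitSquare = ⋂ i, (fun p : Plane => p i) ⁻¹' Set.Icc (0 : ℝ) 1 := by
    ext p; simp [unitSquare]
  rw [this]
  exact MeasurableSet.iInter fun i => measurableSet_Icc.preimage (by fun_prop)

instance : IsProbabilityMeasure squareMeasure := by
  constructor
  have h :=
    measurePreserving_coord_squareMeasure.measure_preimage MeasurableSet.univ.nullMeasurableSet
  rw [Set.preimage_univ] at h
  rw [h, ← Set.univ_prod_univ, Measure.prod_prod]
  simp

lemma volume_unitSquare : volume unitSquare = 1 := by
  have h : squareMeasure Set.univ = 1 := measure_univ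
  simpa [squareMeasure] using h

lemma measurable_vec {α : Type*} [MeasurableSpace α] {f g : α → ℝ} (hf : Measurable f)
    (hg : Measurable g) : Measurable fun x => (!₂[f x, g x] : Plane) := by
  refine (WithLp.measurable_toLp 2 _).comp (measurable_pi_lambda _ fun i => ?_)
  fin_cases i
  · exact hf
  · exact hg

lemma lintegral_squareMeasure {h : Plane → ℝ≥0∞} (hh : Measurable h) :
    ∫⁻ p, h p ∂squareMeasure
      = ∫⁻ x in Set.Icc (0 : ℝ) 1, ∫⁻ y in Set.Icc (0 : ℝ) 1, h !₂[x, y] := by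
  have hm : Measurable fun q : ℝ × ℝ => h !₂[q.1, q.2] :=
    hh.comp (measurable_vec measurable_fst measurable_snd)
  rw [← lintegral_prod _ hm.aemeasurable, ← measurePreserving_coord_squareMeasure.lintegral_comp hm]
  refine lintegral_congr fun p => congrArg h ?_
  ext i
  fin_cases i <;> rfl

lemma ae_coord_zero_ne (a : ℝ) : ∀ᵐ p ∂squareMeasure, p 0 ≠ a := by
  have h : ∀ᵐ q ∂((volume.restrict (Set.Icc (0 : ℝ) 1)).prod (volume.restrict (Set.Icc (0 : ℝ) 1))),
      q.1 ≠ a := Measure.quasiMeasurePreserving_fst.ae (Measure.ae_ne _ a)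
  exact measurePreserving_coord_squareMeasure.quasiMeasurePreserving.ae h

lemma ae_coord_one_ne (a : ℝ) : ∀ᵐ p ∂squareMeasure, p 1 ≠ a := by
  have h : ∀ᵐ q ∂((volume.restrict (Set.Icc (0 : ℝ) 1)).prod (volume.restrict (Set.Icc (0 : ℝ) 1))),
      q.2 ≠ a := Measure.quasiMeasurePreserving_snd.ae (Measure.ae_ne _ a)
  exact measurePreserving_coord_squareMeasure.quasiMeasurePreserving.ae h

lemma ae_mem_unitSquare : ∀ᵐ p ∂squareMeasure, p ∈ unitSquare :=
  ae_restrict_mem measurableSet_unitSquare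

lemma ae_coord_one_mem_Ioo : ∀ᵐ p ∂squareMeasure, p 1 ∈ Set.Ioo (0 : ℝ) 1 := by
  filter_upwards [ae_mem_unitSquare, ae_coord_one_ne 0, ae_coord_one_ne 1] with p hp h0 h1
  exact ⟨(hp 1).1.lt_of_ne' h0, (hp 1).2.lt_of_ne h1⟩

/-- `x` lies strictly between the first coordinates of `p` and `q`. -/
def IsMiddle (p q : Plane) (x : ℝ) : Prop := (p 0 - x) * (q 0 - x) < 0

/-- The length of the set of `y` for which the triangle with vertices `p`, `q` and `(x, y)` has area
less than `t`, divided by `t`, and set to zero unless `x` is between the first coordinates of `p`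
and `q`. -/
noncomputable def sliceRatio (t : ℝ) (z : (Plane × Plane) × ℝ) : ℝ≥0∞ :=
  {z : (Plane × Plane) × ℝ | IsMiddle z.1.1 z.1.2 z.2}.indicator (fun z =>
    volume.restrict (Set.Icc (0 : ℝ) 1) {y | |orient z.1.1 z.1.2 !₂[z.2, y]| < 2 * t}
      / ENNReal.ofReal t) z

/-- The limit of `sliceRatio t` as `t → 0`. -/
noncomputable def sliceLimit (z : (Plane × Plane) × ℝ) : ℝ≥0∞ :=
  {z : (Plane × Plane) × ℝ | IsMiddle z.1.1 z.1.2 z.2}.indicator (fun z =>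
    ENNReal.ofReal (4 / |z.1.2 0 - z.1.1 0|)) z

lemma measurableSet_isMiddle {α : Type*} [MeasurableSpace α] {f g : α → Plane} {h : α → ℝ}
    (hf : Measurable f) (hg : Measurable g) (hh : Measurable h) :
    MeasurableSet {x | IsMiddle (f x) (g x) (h x)} := by
  unfold IsMiddle
  exact measurableSet_lt (by fun_prop) measurable_const

lemma measurableSet_abs_orient_lt {α : Type*} [MeasurableSpace α] {f g h : α → Plane}
    (hf : Measurable f) (hg : Measurable g) (hh : Measurable h) (t : ℝ) :
    MeasurableSet {x | |orient (f x) (g x) (h x)| < t} :=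
  measurableSet_lt (continuous_abs.measurable.comp (measurable_orient hf hg hh)) measurable_const

lemma measurable_sliceRatio (t : ℝ) : Measurable (sliceRatio t) := by
  refine Measurable.indicator ?_ (measurableSet_isMiddle (by fun_prop) (by fun_prop) (by fun_prop))
  refine Measurable.div_const ?_ _
  have hs : MeasurableSet {w : ((Plane × Plane) × ℝ) × ℝ |
      |orient w.1.1.1 w.1.1.2 !₂[w.1.2, w.2]| < 2 * t} :=
    measurableSet_abs_orient_lt (by fun_prop) (by fun_prop)
      (measurable_vec (by fun_prop) (by fun_prop)) _
  exact measurable_measure_prodMk_left hs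

lemma measurable_sliceLimit : Measurable sliceLimit := by
  refine Measurable.indicator ?_ (measurableSet_isMiddle (by fun_prop) (by fun_prop) (by fun_prop))
  fun_prop

lemma IsMiddle.ne {p q : Plane} {x : ℝ} (h : IsMiddle p q x) : q 0 - p 0 ≠ 0 := by
  intro h0
  have h1 : q 0 = p 0 := by linarith
  unfold IsMiddle at h
  rw [h1] at h
  nlinarith [mul_self_nonneg (p 0 - x)]

/-- The points of the vertical line at `x` that span with `p` and `q` a triangle of area less than
`t` form an interval about the point of the line `pq` above `x`. -/
lemma setOf_abs_orient_lt_eq_ball {p q : Plane} {x : ℝ} (hd : q 0 - p 0 ≠ 0) (t : ℝ) :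
    {y | |orient p q !₂[x, y]| < 2 * t}
      = Metric.ball (p 1 + (q 1 - p 1) * ((x - p 0) / (q 0 - p 0))) (2 * t / |q 0 - p 0|) := by
  ext y
  have e : orient p q !₂[x, y]
      = (y - (p 1 + (q 1 - p 1) * ((x - p 0) / (q 0 - p 0)))) * (q 0 - p 0) := by
    simp only [orient]
    field_simp
    simp
    ring
  rw [Set.mem_ofPred_eq, Metric.mem_ball, Real.dist_eq, e, abs_mul, lt_div_iff₀ (abs_pos.2 hd)]

lemma volume_ball_div {d t : ℝ} (c : ℝ) (hd : d ≠ 0) (ht : 0 < t) :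
    volume (Metric.ball c (2 * t / |d|)) / ENNReal.ofReal t = ENNReal.ofReal (4 / |d|) := by
  rw [Real.volume_ball, ← ENNReal.ofReal_div_of_pos ht]
  congr 1
  field_simp
  norm_num

lemma sliceRatio_le {t : ℝ} (ht : 0 < t) (z : (Plane × Plane) × ℝ) :
    sliceRatio t z ≤ sliceLimit z := by
  unfold sliceRatio sliceLimit
  by_cases hz : z ∈ {z : (Plane × Plane) × ℝ | IsMiddle z.1.1 z.1.2 z.2}
  · rw [Set.indicator_of_mem hz, Set.indicator_of_mem hz, setOf_abs_orient_lt_eq_ball hz.ne,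
      ← volume_ball_div _ hz.ne ht]
    exact ENNReal.div_le_div_right (Measure.restrict_apply_le _ _) _
  · rw [Set.indicator_of_notMem hz, Set.indicator_of_notMem hz]

lemma tendsto_sliceRatio {z : (Plane × Plane) × ℝ} (h1 : z.1.1 1 ∈ Set.Ioo (0 : ℝ) 1)
    (h2 : z.1.2 1 ∈ Set.Ioo (0 : ℝ) 1) :
    Tendsto (fun t => sliceRatio t z) (𝓝[>] 0) (𝓝 (sliceLimit z)) := by
  obtain ⟨⟨p, q⟩, x⟩ := z
  simp only at h1 h2
  by_cases hz : IsMiddle p q x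
  swap
  · simp [sliceRatio, sliceLimit, hz]
  have hd := hz.ne
  simp only [sliceRatio, sliceLimit, Set.indicator_of_mem (show ((p, q), x) ∈
    {z : (Plane × Plane) × ℝ | IsMiddle z.1.1 z.1.2 z.2} from hz), setOf_abs_orient_lt_eq_ball hd]
  set l := p 1 + (q 1 - p 1) * ((x - p 0) / (q 0 - p 0)) with hl
  -- The point of the line `pq` above `x` is a convex combination of `p` and `q`.
  have hl01 : l ∈ Set.Ioo (0 : ℝ) 1 := by
    set u := (x - p 0) / (q 0 - p 0) with hu
    have hu0 : 0 < u ∧ u < 1 := by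
      unfold IsMiddle at hz
      rw [hu]
      rcases mul_neg_iff.1 hz with ⟨h, h'⟩ | ⟨h, h'⟩
      · rw [div_pos_iff, div_lt_one_of_neg (by linarith)]
        exact ⟨Or.inr ⟨by linarith, by linarith⟩, by linarith⟩
      · rw [div_pos_iff, div_lt_one (by linarith)]
        exact ⟨Or.inl ⟨by linarith, by linarith⟩, by linarith⟩
    have hc : l = (1 - u) * p 1 + u * q 1 := by rw [hl]; ring
    have hmem := (convex_Ioo (0 : ℝ) 1) h1 h2 (sub_nonneg.2 hu0.2.le) hu0.1.le (by ring)
    rwa [smul_eq_mul, smul_eq_mul, ← hc] at hmem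
  refine tendsto_const_nhds.congr' ?_
  have hr : Tendsto (fun t : ℝ => 2 * t / |q 0 - p 0|) (𝓝[>] 0) (𝓝 0) := by
    have : Tendsto (fun t : ℝ => 2 * t / |q 0 - p 0|) (𝓝 0) (𝓝 (2 * 0 / |q 0 - p 0|)) :=
      (by fun_prop : Continuous fun t : ℝ => 2 * t / |q 0 - p 0|).tendsto 0
    simp only [mul_zero, zero_div] at this
    exact this.mono_left nhdsWithin_le_nhds
  filter_upwards [hr.eventually (gt_mem_nhds hl01.1),
    hr.eventually (gt_mem_nhds (sub_pos.2 hl01.2)), self_mem_nhdsWithin] with t ha hb ht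
  have hsub : Metric.ball l (2 * t / |q 0 - p 0|) ⊆ Set.Icc 0 1 := by
    rw [Real.ball_eq_Ioo]
    intro y hy
    exact ⟨by linarith [hy.1], by linarith [hy.2]⟩
  rw [Measure.restrict_apply measurableSet_ball, Set.inter_eq_left.2 hsub, volume_ball_div l hd ht]

lemma setOf_isMiddle (p q : Plane) :
    {x | IsMiddle p q x} = Set.Ioo (min (p 0) (q 0)) (max (p 0) (q 0)) := by
  ext x
  simp only [IsMiddle, Set.mem_ofPred_eq, mul_neg_iff, Set.mem_Ioo, min_lt_iff, lt_max_iff,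
    sub_pos, sub_neg]
  constructor
  · rintro (⟨h, h'⟩ | ⟨h, h'⟩)
    · exact ⟨Or.inr h', Or.inl h⟩
    · exact ⟨Or.inl h, Or.inr h'⟩
  · rintro ⟨h | h, h' | h'⟩
    · exact absurd h h'.not_gt
    · exact Or.inr ⟨h, h'⟩
    · exact Or.inl ⟨h', h⟩
    · exact absurd h h'.not_gt

/-- The weight `4 / |q₀ - p₀|` of a slice is balanced by the width of the range for `x`. -/
lemma lintegral_sliceLimit :
    ∫⁻ z, sliceLimit z ∂((squareMeasure.prod squareMeasure).prod
      (volume.restrict (Set.Icc (0 : ℝ) 1))) = 4 := by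
  rw [lintegral_prod _ measurable_sliceLimit.aemeasurable,
    lintegral_prod _ measurable_sliceLimit.lintegral_prod_right'.aemeasurable]
  have : ∀ᵐ p ∂squareMeasure,
      ∫⁻ q, (∫⁻ x in Set.Icc (0 : ℝ) 1, sliceLimit ((p, q), x)) ∂squareMeasure = 4 := by
    filter_upwards [ae_mem_unitSquare] with p hp
    have : ∀ᵐ q ∂squareMeasure, ∫⁻ x in Set.Icc (0 : ℝ) 1, sliceLimit ((p, q), x) = 4 := by
      filter_upwards [ae_mem_unitSquare, ae_coord_zero_ne (p 0)] with q hq hne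
      have e : ∀ x, sliceLimit ((p, q), x)
          = (Set.Ioo (min (p 0) (q 0)) (max (p 0) (q 0))).indicator
              (fun _ => ENNReal.ofReal (4 / |q 0 - p 0|)) x := fun x => by
        rw [← setOf_isMiddle]; rfl
      simp_rw [e]
      rw [lintegral_indicator_const measurableSet_Ioo, Measure.restrict_apply measurableSet_Ioo,
        Set.inter_eq_left.2, Real.volume_Ioo, max_sub_min_eq_abs, abs_sub_comm,
        ← ENNReal.ofReal_mul (by positivity), abs_sub_comm]
      · have : |q 0 - p 0| ≠ 0 := abs_ne_zero.2 (sub_ne_zero.2 hne)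
        rw [div_mul_cancel₀]
        · simp
        · simpa [abs_sub_comm] using this
      · intro x hx
        exact ⟨(le_min (hp 0).1 (hq 0).1).trans hx.1.le, hx.2.le.trans (max_le (hp 0).2 (hq 0).2)⟩
    rw [lintegral_congr_ae this]
    simp
  rw [lintegral_congr_ae this]
  simp

lemma tendsto_lintegral_sliceRatio :
    Tendsto (fun t => ∫⁻ z, sliceRatio t z ∂((squareMeasure.prod squareMeasure).prod
      (volume.restrict (Set.Icc (0 : ℝ) 1)))) (𝓝[>] 0) (𝓝 4) := by
  rw [← lintegral_sliceLimit]
  refine tendsto_lintegral_filter_of_dominated_convergence sliceLimit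
    (Eventually.of_forall measurable_sliceRatio) ?_ ?_ ?_
  · filter_upwards [self_mem_nhdsWithin] with t ht
    exact ae_of_all _ (sliceRatio_le ht)
  · rw [lintegral_sliceLimit]; simp
  · have h1 : ∀ᵐ z ∂((squareMeasure.prod squareMeasure).prod
        (volume.restrict (Set.Icc (0 : ℝ) 1))), z.1.1 1 ∈ Set.Ioo (0 : ℝ) 1 :=
      (Measure.quasiMeasurePreserving_fst.comp Measure.quasiMeasurePreserving_fst).ae
        ae_coord_one_mem_Ioo
    have h2 : ∀ᵐ z ∂((squareMeasure.prod squareMeasure).prod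
        (volume.restrict (Set.Icc (0 : ℝ) 1))), z.1.2 1 ∈ Set.Ioo (0 : ℝ) 1 :=
      (Measure.quasiMeasurePreserving_snd.comp Measure.quasiMeasurePreserving_fst).ae
        ae_coord_one_mem_Ioo
    filter_upwards [h1, h2] with z hz1 hz2
    exact tendsto_sliceRatio hz1 hz2

lemma measurePreserving_pi_fin_three (ν : Measure Plane) [SigmaFinite ν] :
    MeasurePreserving (fun p : Fin 3 → Plane => (p 0, p 1, p 2)) (Measure.pi fun _ => ν)
      (ν.prod (ν.prod ν)) :=
  ((MeasurePreserving.id ν).prod (measurePreserving_finTwoArrow ν)).comp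
    (measurePreserving_piFinSuccAbove (fun _ : Fin 3 => ν) 0)

/-- The third point spans with the others a triangle of area less than `t`, and its first coordinate
lies between theirs. -/
def thirdMiddle (t : ℝ) : Set (Plane × Plane × Plane) :=
  {z | IsMiddle z.1 z.2.1 (z.2.2 0) ∧ |orient z.1 z.2.1 z.2.2| < 2 * t}

lemma measurableSet_thirdMiddle (t : ℝ) : MeasurableSet (thirdMiddle t) :=
  (measurableSet_isMiddle (by fun_prop) (by fun_prop) (by fun_prop)).inter
    (measurableSet_abs_orient_lt (by fun_prop) (by fun_prop) (by fun_prop) _)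

lemma measure_thirdMiddle {t : ℝ} (ht : 0 < t) :
    squareMeasure.prod (squareMeasure.prod squareMeasure) (thirdMiddle t)
      = ENNReal.ofReal t * ∫⁻ z, sliceRatio t z ∂((squareMeasure.prod squareMeasure).prod
          (volume.restrict (Set.Icc (0 : ℝ) 1))) := by
  have ht0 : ENNReal.ofReal t ≠ 0 := by simpa using ht
  have h1 : Measurable ((thirdMiddle t).indicator (1 : Plane × Plane × Plane → ℝ≥0∞)) :=
    measurable_one.indicator (measurableSet_thirdMiddle t)
  rw [← lintegral_indicator_one (measurableSet_thirdMiddle t), lintegral_prod _ h1.aemeasurable,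
    lintegral_prod _ (measurable_sliceRatio t).aemeasurable,
    lintegral_prod _ (measurable_sliceRatio t).lintegral_prod_right'.aemeasurable,
    ← lintegral_const_mul _ (measurable_sliceRatio t).lintegral_prod_right'.lintegral_prod_right']
  refine lintegral_congr fun p => ?_
  have h2 := h1.comp (measurable_prodMk_left (x := p))
  refine (lintegral_prod _ h2.aemeasurable).trans ?_
  have h4 : Measurable fun q => ∫⁻ x in Set.Icc (0 : ℝ) 1, sliceRatio t ((p, q), x) :=
    (measurable_sliceRatio t).lintegral_prod_right'.comp measurable_prodMk_left
  rw [← lintegral_const_mul _ h4]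
  refine lintegral_congr fun q => ?_
  have h3 := h2.comp (measurable_prodMk_left (x := q))
  have h5 : Measurable fun x => sliceRatio t ((p, q), x) :=
    (measurable_sliceRatio t).comp measurable_prodMk_left
  rw [← lintegral_const_mul _ h5]
  refine (lintegral_squareMeasure h3).trans (lintegral_congr fun x => ?_)
  by_cases hz : IsMiddle p q x
  · have e : ∀ y, (thirdMiddle t).indicator (1 : Plane × Plane × Plane → ℝ≥0∞) (p, q, !₂[x, y])
        = {y | |orient p q !₂[x, y]| < 2 * t}.indicator 1 y := fun y => by
      have hiff : (p, q, !₂[x, y]) ∈ thirdMiddle t ↔ |orient p q !₂[x, y]| < 2 * t :=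
        ⟨fun h => h.2, fun h => ⟨hz, h⟩⟩
      classical simp only [Set.indicator_apply, hiff, Set.mem_ofPred_eq, Pi.one_apply]
    have hm : MeasurableSet {y : ℝ | |orient p q !₂[x, y]| < 2 * t} :=
      measurableSet_abs_orient_lt measurable_const measurable_const
        (measurable_vec measurable_const measurable_id) _
    simp only [Function.comp_apply]
    simp_rw [e]
    rw [lintegral_indicator_one hm, sliceRatio,
      Set.indicator_of_mem (show ((p, q), x) ∈
        {z : (Plane × Plane) × ℝ | IsMiddle z.1.1 z.1.2 z.2} from hz),
      ENNReal.mul_div_cancel ht0 ENNReal.ofReal_ne_top]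
  · have e : ∀ y, (thirdMiddle t).indicator (1 : Plane × Plane × Plane → ℝ≥0∞) (p, q, !₂[x, y])
        = 0 := fun y => Set.indicator_of_notMem (fun h => hz h.1) _
    simp only [Function.comp_apply]
    simp_rw [e]
    rw [sliceRatio, Set.indicator_of_notMem (show ((p, q), x) ∉
        {z : (Plane × Plane) × ℝ | IsMiddle z.1.1 z.1.2 z.2} from hz)]
    simp

lemma measurePreserving_swap_right (ν : Measure Plane) [SFinite ν] :
    MeasurePreserving (fun z : Plane × Plane × Plane => (z.1, z.2.2, z.2.1))
      (ν.prod (ν.prod ν)) (ν.prod (ν.prod ν)) :=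
  (MeasurePreserving.id ν).prod Measure.measurePreserving_swap

lemma measurePreserving_swap_left (ν : Measure Plane) [SFinite ν] :
    MeasurePreserving (fun z : Plane × Plane × Plane => (z.2.1, z.1, z.2.2))
      (ν.prod (ν.prod ν)) (ν.prod (ν.prod ν)) :=
  (measurePreserving_prodAssoc ν ν ν).comp
    ((Measure.measurePreserving_swap.prod (MeasurePreserving.id ν)).comp
      (measurePreserving_prodAssoc ν ν ν).symm)

lemma ae_coord_zero_ne_prod :
    ∀ᵐ z ∂squareMeasure.prod squareMeasure, z.1 0 ≠ z.2 0 := by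
  have hm : MeasurableSet {z : Plane × Plane | z.1 0 ≠ z.2 0} :=
    (measurableSet_eq_fun (by fun_prop) (by fun_prop)).compl
  refine (Measure.ae_prod_iff_ae_ae hm).2 ?_
  refine ae_of_all _ fun p => ?_
  filter_upwards [ae_coord_zero_ne (p 0)] with q hq using hq.symm

/-- By symmetry, each of the three points is the middle one with the same probability. -/
lemma measure_abs_orient_lt (t : ℝ) :
    squareMeasure.prod (squareMeasure.prod squareMeasure)
        {z | |orient z.1 z.2.1 z.2.2| < 2 * t}
      = 3 * squareMeasure.prod (squareMeasure.prod squareMeasure) (thirdMiddle t) := by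
  set P := squareMeasure.prod (squareMeasure.prod squareMeasure) with hP
  have hm := measurableSet_thirdMiddle t
  have hR := measurePreserving_swap_right squareMeasure
  have hL := measurePreserving_swap_left squareMeasure
  have hmR := hR.measurable hm
  have hmRL := hL.measurable hmR
  have e1 := hR.measure_preimage hm.nullMeasurableSet
  have e2 := hL.measure_preimage hmR.nullMeasurableSet
  set S := thirdMiddle t with hS
  set S1 := (fun z : Plane × Plane × Plane => (z.1, z.2.2, z.2.1)) ⁻¹' S with hS1
  set S2 := (fun z : Plane × Plane × Plane => (z.2.1, z.1, z.2.2)) ⁻¹' S1 with hS2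
  have hd1 : Disjoint S S1 := by
    rw [Set.disjoint_left]
    rintro ⟨a, b, c⟩ h h'
    simp only [hS, hS1, thirdMiddle, IsMiddle, Set.mem_preimage, Set.mem_ofPred_eq] at h h'
    rcases mul_neg_iff.1 h.1 with h1 | h1 <;> rcases mul_neg_iff.1 h'.1 with h2 | h2 <;> linarith
  have hd2 : Disjoint (S ∪ S1) S2 := by
    rw [Set.disjoint_left]
    rintro ⟨a, b, c⟩ h h'
    simp only [hS, hS1, hS2, thirdMiddle, IsMiddle, Set.mem_preimage, Set.mem_ofPred_eq,
      Set.mem_union] at h h'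
    rcases mul_neg_iff.1 h'.1 with h2 | h2 <;> rcases h with h | h <;>
      rcases mul_neg_iff.1 h.1 with h1 | h1 <;> linarith
  have key : ({z | |orient z.1 z.2.1 z.2.2| < 2 * t} : Set (Plane × Plane × Plane))
      =ᵐ[P] ((S ∪ S1) ∪ S2 : Set (Plane × Plane × Plane)) := by
    have hne1 : ∀ᵐ z ∂P, z.2.1 0 ≠ z.2.2 0 :=
      Measure.quasiMeasurePreserving_snd.ae ae_coord_zero_ne_prod
    have hne2 : ∀ᵐ z ∂P, z.1 0 ≠ z.2.2 0 := hL.quasiMeasurePreserving.ae hne1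
    have hne3 : ∀ᵐ z ∂P, z.1 0 ≠ z.2.1 0 := hR.quasiMeasurePreserving.ae hne2
    rw [eventuallyEq_set]
    filter_upwards [hne1, hne2, hne3] with z h1 h2 h3
    obtain ⟨a, b, c⟩ := z
    simp only at h1 h2 h3
    have o1 : |orient a c b| = |orient a b c| := by rw [orient_swap_right, abs_neg]
    have o2 : |orient b c a| = |orient a b c| := by
      rw [orient_swap_right, orient_swap_left, neg_neg]
    simp only [hS, hS1, hS2, thirdMiddle, IsMiddle, Set.mem_preimage, Set.mem_ofPred_eq,
      Set.mem_union, o1, o2, ← or_and_right, iff_and_self, mul_neg_iff, sub_pos, sub_neg]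
    intro _
    rcases lt_or_gt_of_ne h1 with h1 | h1 <;> rcases lt_or_gt_of_ne h2 with h2 | h2 <;>
      rcases lt_or_gt_of_ne h3 with h3 | h3 <;> tauto
  rw [measure_congr key, measure_union hd2 hmRL, measure_union hd1 hmR, e2, e1]
  ring

/-- The law of the area of the triangle spanned by three independent uniform points of the unit
square. -/
noncomputable def areaLaw : Measure ℝ :=
  (Measure.pi fun _ : Fin 3 => squareMeasure).map fun p => |orient (p 0) (p 1) (p 2)| / 2

lemma measurable_area : Measurable fun p : Fin 3 → Plane => |orient (p 0) (p 1) (p 2)| / 2 :=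
  (continuous_abs.measurable.comp (measurable_orient (measurable_pi_apply 0)
    (measurable_pi_apply 1) (measurable_pi_apply 2))).div_const 2

instance : IsProbabilityMeasure areaLaw := Measure.isProbabilityMeasure_map
  measurable_area.aemeasurable

lemma areaLaw_Iio (t : ℝ) :
    areaLaw (Set.Iio t)
      = 3 * squareMeasure.prod (squareMeasure.prod squareMeasure) (thirdMiddle t) := by
  rw [areaLaw, Measure.map_apply measurable_area measurableSet_Iio, ← measure_abs_orient_lt,
    ← (measurePreserving_pi_fin_three squareMeasure).measure_preimage
      (measurableSet_abs_orient_lt (by fun_prop) (by fun_prop) (by fun_prop) _).nullMeasurableSet]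
  congr 1
  ext p
  simp only [Set.mem_preimage, Set.mem_Iio, Set.mem_ofPred_eq]
  rw [div_lt_iff₀ two_pos, mul_comm]

/-- The area of a random triangle in the unit square is less than `t` with probability `~ 12 t`. -/
theorem tendsto_areaLaw_Iio_div :
    Tendsto (fun t => areaLaw.real (Set.Iio t) / t) (𝓝[>] 0) (𝓝 12) := by
  have h := (ENNReal.tendsto_toReal (ENNReal.mul_ne_top (by simp) (by simp))).comp
    (ENNReal.Tendsto.const_mul tendsto_lintegral_sliceRatio (a := 3) (Or.inr (by simp)))
  have e : (3 * 4 : ℝ≥0∞).toReal = 12 := by norm_num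
  rw [e] at h
  refine h.congr' ?_
  filter_upwards [self_mem_nhdsWithin] with t ht
  have ht0 : (0 : ℝ) < t := ht
  rw [Function.comp_apply, Measure.real, areaLaw_Iio, measure_thirdMiddle ht, ENNReal.toReal_mul,
    ENNReal.toReal_mul, ENNReal.toReal_mul, ENNReal.toReal_ofReal ht0.le]
  field_simp

lemma areaLaw_Iic_zero : areaLaw (Set.Iic 0) = 0 := by
  -- `F t = t · (F t / t)` tends to `0`.
  have h0 : Tendsto (fun t => areaLaw.real (Set.Iio t)) (𝓝[>] 0) (𝓝 0) := by
    have h1 : Tendsto (fun t : ℝ => t) (𝓝[>] 0) (𝓝 0) := nhdsWithin_le_nhds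
    have h2 := tendsto_areaLaw_Iio_div.mul h1
    rw [mul_zero] at h2
    refine h2.congr' ?_
    filter_upwards [self_mem_nhdsWithin] with t ht
    exact div_mul_cancel₀ _ (ne_of_gt ht)
  have h1 : areaLaw.real (Set.Iic 0) ≤ 0 := by
    refine ge_of_tendsto h0 ?_
    filter_upwards [self_mem_nhdsWithin] with t ht
    exact measureReal_mono (Set.Iic_subset_Iio.2 ht)
  exact (measureReal_eq_zero_iff).1 (le_antisymm h1 measureReal_nonneg)

lemma ae_orient_ne_zero :
    ∀ᵐ p ∂(Measure.pi fun _ : Fin 3 => squareMeasure), orient (p 0) (p 1) (p 2) ≠ 0 := by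
  have h : ∀ᵐ a ∂areaLaw, a ∉ Set.Iic 0 := measure_eq_zero_iff_ae_notMem.1 areaLaw_Iic_zero
  filter_upwards [ae_of_ae_map measurable_area.aemeasurable h] with p hp h0
  simp [h0] at hp

lemma convex_unitSquare : Convex ℝ unitSquare := by
  intro x hx y hy a b ha hb hab i
  exact (convex_Icc (0 : ℝ) 1) (hx i) (hy i) ha hb hab

lemma openTriangle_subset_convexHull (p : Fin 3 → Plane) :
    openTriangle (p 0) (p 1) (p 2) ⊆ convexHull ℝ (Set.range p) := by
  by_cases h : orient (p 0) (p 1) (p 2) = 0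
  · intro x hx
    simp [openTriangle, h] at hx
  · rw [← interior_convexHull_eq_openTriangle ((affineIndependent_iff_orient_ne_zero p).2 h)]
    exact interior_subset

/-- For vertices in the unit square, the area of a triangle is the probability that it contains a
uniform point. -/
lemma squareMeasure_openTriangle {p : Fin 3 → Plane} (hp : ∀ i, p i ∈ unitSquare) :
    squareMeasure (openTriangle (p 0) (p 1) (p 2))
      = ENNReal.ofReal (|orient (p 0) (p 1) (p 2)| / 2) := by
  have hsub : openTriangle (p 0) (p 1) (p 2) ⊆ unitSquare :=
    (openTriangle_subset_convexHull p).trans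
      (convexHull_min (Set.range_subset_iff.2 hp) convex_unitSquare)
  rw [squareMeasure, Measure.restrict_apply' measurableSet_unitSquare, Set.inter_eq_left.2 hsub,
    volume_openTriangle]

lemma ae_pi_mem_unitSquare {ι : Type*} [Fintype ι] :
    ∀ᵐ p ∂(Measure.pi fun _ : ι => squareMeasure), ∀ i, p i ∈ unitSquare := by
  rw [ae_all_iff]
  exact fun i => (measurePreserving_eval (fun _ : ι => squareMeasure) i).quasiMeasurePreserving.ae
    ae_mem_unitSquare

lemma ae_areaLaw_mem_Icc : ∀ᵐ a ∂areaLaw, a ∈ Set.Icc (0 : ℝ) 1 := by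
  refine (ae_map_iff measurable_area.aemeasurable measurableSet_Icc).2 ?_
  filter_upwards [ae_pi_mem_unitSquare] with p hp
  refine ⟨by positivity, ?_⟩
  have h := squareMeasure_openTriangle hp
  have h1 : squareMeasure (openTriangle (p 0) (p 1) (p 2)) ≤ 1 := prob_le_one
  rw [h, ENNReal.ofReal_le_one] at h1
  exact h1

/-! ### The number of points in a random triangle -/

section Binomial

variable {X ι : Type*} [MeasurableSpace X] [Fintype ι]

open scoped Classical in
/-- The number of successes in independent trials is binomially distributed. -/
lemma measureReal_pi_card_eq (ν : Measure X) [IsProbabilityMeasure ν] {T : Set X}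
    (hT : MeasurableSet T) (k : ℕ) :
    (Measure.pi fun _ : ι => ν).real {y | (Finset.univ.filter fun j => y j ∈ T).card = k}
      = (bernsteinPolynomial ℝ (Fintype.card ι) k).eval (ν.real T) := by
  have h : {y : ι → X | (Finset.univ.filter fun j => y j ∈ T).card = k}
      = ⋃ S ∈ (Finset.univ : Finset ι).powersetCard k,
          Set.univ.pi fun j => if j ∈ S then T else Tᶜ := by
    ext y
    simp only [Set.mem_ofPred_eq, Set.mem_iUnion, Finset.mem_powersetCard, Set.mem_univ_pi,
      exists_prop, Finset.subset_univ, true_and]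
    constructor
    · intro hy
      refine ⟨_, hy, fun j => ?_⟩
      by_cases hj : y j ∈ T <;> simp [hj]
    · rintro ⟨S, hS, hy⟩
      rw [← hS]
      congr 1
      ext j
      have := hy j
      by_cases hj : j ∈ S <;> simp_all
  have hm : ∀ S : Finset ι, MeasurableSet (Set.univ.pi fun j => if j ∈ S then T else Tᶜ) := by
    intro S
    refine MeasurableSet.univ_pi fun j => ?_
    split_ifs
    · exact hT
    · exact hT.compl
  rw [h, measureReal_biUnion_finset _ fun S _ => hm S]
  · have : ∀ S ∈ (Finset.univ : Finset ι).powersetCard k,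
        (Measure.pi fun _ : ι => ν).real (Set.univ.pi fun j => if j ∈ S then T else Tᶜ)
          = ν.real T ^ k * (1 - ν.real T) ^ (Fintype.card ι - k) := by
      intro S hS
      rw [Finset.mem_powersetCard] at hS
      rw [Measure.real, Measure.pi_pi, ENNReal.toReal_prod]
      have e : ∀ j, (ν (if j ∈ S then T else Tᶜ)).toReal
          = if j ∈ S then ν.real T else 1 - ν.real T := by
        intro j
        split_ifs
        · rfl
        · exact probReal_compl_eq_one_sub hT
      simp_rw [e]
      rw [Finset.prod_ite, Finset.prod_const, Finset.prod_const, Finset.filter_mem_eq_inter,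
        Finset.univ_inter, hS.2, Finset.filter_notMem_eq_sdiff, ← Finset.compl_eq_univ_sdiff,
        Finset.card_compl, hS.2]
    rw [Finset.sum_congr rfl this, Finset.sum_const, Finset.card_powersetCard, Finset.card_univ,
      nsmul_eq_mul]
    simp [bernsteinPolynomial, mul_assoc]
  · intro S _ S' _ hne
    rw [Function.onFun, Set.disjoint_left]
    intro y hy hy'
    refine hne (Finset.ext fun j => ?_)
    have h1 := hy j trivial
    have h2 := hy' j trivial
    by_cases hj : j ∈ S <;> by_cases hj' : j ∈ S' <;> simp_all

open scoped Classical in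
lemma measurable_card_filter {α : Type*} [MeasurableSpace α] {P : ι → α → Prop}
    (hP : ∀ j, MeasurableSet {x | P j x}) :
    Measurable fun x => (Finset.univ.filter fun j => P j x).card := by
  simp_rw [Finset.card_filter]
  exact Finset.measurable_fun_sum _ fun j _ =>
    Measurable.ite (hP j) measurable_const measurable_const

open scoped Classical in
lemma measureReal_pi_card_le (ν : Measure X) [IsProbabilityMeasure ν] {T : Set X}
    (hT : MeasurableSet T) (s : ℕ) :
    (Measure.pi fun _ : ι => ν).real {y | (Finset.univ.filter fun j => y j ∈ T).card ≤ s}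
      = (binomialCdf (Fintype.card ι) s).eval (ν.real T) := by
  have h : {y : ι → X | (Finset.univ.filter fun j => y j ∈ T).card ≤ s}
      = ⋃ k ∈ Finset.range (s + 1), {y | (Finset.univ.filter fun j => y j ∈ T).card = k} := by
    ext y
    simp
  rw [h, measureReal_biUnion_finset, binomialCdf, Polynomial.eval_finsetSum]
  · exact Finset.sum_congr rfl fun k _ => measureReal_pi_card_eq ν hT k
  · intro k _ k' _ hne
    rw [Function.onFun, Set.disjoint_left]
    exact fun y hy hy' => hne (hy.symm.trans hy')
  · intro k _
    exact measurable_card_filter (fun j => hT.preimage (measurable_pi_apply j))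
      (measurableSet_singleton k)

end Binomial

/-- The coordinates picked by an embedding and the remaining ones are independent. -/
lemma measurePreserving_split_embedding {X ι κ : Type*} [MeasurableSpace X] [Fintype ι] [Fintype κ]
    (ν : Measure X) [SigmaFinite ν] (e : κ ↪ ι) [hF : Fintype {j // j ∉ Set.range e}] :
    MeasurePreserving
      (fun p : ι → X => (fun k => p (e k), fun j : {j // j ∉ Set.range e} => p j))
      (Measure.pi fun _ => ν) ((Measure.pi fun _ => ν).prod (Measure.pi fun _ => ν)) := by
  classical
  obtain rfl : hF = Subtype.fintype _ := Subsingleton.elim _ _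
  have h1 := measurePreserving_piEquivPiSubtypeProd (fun _ : ι => ν) (fun j => j ∈ Set.range e)
  let _ : Fintype {j // j ∈ Set.range e} := Subtype.fintype _
  let f : {j // j ∈ Set.range e} ≃ κ := (Equiv.ofInjective e e.injective).symm
  have h2 := measurePreserving_piCongrLeft (fun _ : κ => ν) f
  have h3 := (h2.prod (MeasurePreserving.id
    (Measure.pi fun _ : {j // j ∉ Set.range e} => ν))).comp h1
  convert h3 using 1
  funext p
  refine Prod.ext (funext fun k => ?_) rfl
  obtain ⟨a, rfl⟩ := f.surjective k
  have h4 := Equiv.piCongrLeft_apply_apply (fun _ : κ => X) f (fun j => p j.1) a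
  have h5 : e (f a) = a.1 := congrArg Subtype.val
    ((Equiv.ofInjective e e.injective).apply_symm_apply a)
  exact (congrArg p h5).trans h4.symm

open scoped Classical in
/-- The configurations in which the points with the indices `e 0`, `e 1`, `e 2` span a nondegenerate
triangle with at most `s` of the points in its interior. -/
def fewInside {n : ℕ} (s : ℕ) (e : Fin 3 ↪ Fin n) : Set (Fin n → Plane) :=
  {p | orient (p (e 0)) (p (e 1)) (p (e 2)) ≠ 0 ∧
    (Finset.univ.filter fun j => p j ∈ openTriangle (p (e 0)) (p (e 1)) (p (e 2))).card ≤ s}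

lemma measurableSet_fewInside {n : ℕ} (s : ℕ) (e : Fin 3 ↪ Fin n) :
    MeasurableSet (fewInside s e) := by
  classical
  have h1 : Measurable fun p : Fin n → Plane => orient (p (e 0)) (p (e 1)) (p (e 2)) :=
    measurable_orient (by fun_prop) (by fun_prop) (by fun_prop)
  have h2 := measurable_card_filter
    (P := fun j (p : Fin n → Plane) => p j ∈ openTriangle (p (e 0)) (p (e 1)) (p (e 2)))
    fun j => measurableSet_mem_openTriangle (by fun_prop) (by fun_prop) (by fun_prop) (by fun_prop)
  refine MeasurableSet.inter (measurableSet_eq_fun h1 measurable_const).compl ?_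
  exact measurableSet_le h2 measurable_const

/-- Conditionally on the vertices, the number of points in a triangle is binomial, with the area as
parameter. -/
lemma measureReal_fewInside {n : ℕ} (s : ℕ) (e : Fin 3 ↪ Fin n) :
    (Measure.pi fun _ : Fin n => squareMeasure).real (fewInside s e)
      = ∫ a, (binomialCdf (n - 3) s).eval a ∂areaLaw := by
  classical
  set C := {j // j ∉ Set.range e}
  let S : Set ((Fin 3 → Plane) × (C → Plane)) := {z | orient (z.1 0) (z.1 1) (z.1 2) ≠ 0 ∧
    (Finset.univ.filter fun j => z.2 j ∈ openTriangle (z.1 0) (z.1 1) (z.1 2)).card ≤ s}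
  have hS : MeasurableSet S := by
    have h1 : Measurable fun z : (Fin 3 → Plane) × (C → Plane) =>
        orient (z.1 0) (z.1 1) (z.1 2) :=
      measurable_orient (by fun_prop) (by fun_prop) (by fun_prop)
    have h2 := measurable_card_filter (P := fun j (z : (Fin 3 → Plane) × (C → Plane)) =>
        z.2 j ∈ openTriangle (z.1 0) (z.1 1) (z.1 2))
      fun j => measurableSet_mem_openTriangle (by fun_prop) (by fun_prop) (by fun_prop)
        (by fun_prop)
    refine MeasurableSet.inter (measurableSet_eq_fun h1 measurable_const).compl ?_
    exact measurableSet_le h2 measurable_const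
  have hcard : Fintype.card C = n - 3 := by
    have h1 := Fintype.card_subtype_compl (fun j => j ∈ Set.range e)
    have h2 : Fintype.card {j // j ∈ Set.range e} = 3 := by
      rw [Fintype.card_congr (Equiv.ofInjective e e.injective).symm, Fintype.card_fin]
    rw [h2, Fintype.card_fin] at h1
    exact h1
  have hpre : fewInside s e
      = (fun p : Fin n → Plane => (fun k => p (e k), fun j : C => p j)) ⁻¹' S := by
    ext p
    simp only [fewInside, S, Set.mem_ofPred_eq, Set.mem_preimage]
    -- The vertices of a triangle are not in its interior.
    have hc : (Finset.univ.filter fun j =>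
          p j ∈ openTriangle (p (e 0)) (p (e 1)) (p (e 2))).card
        = (Finset.univ.filter fun j : C =>
          p j ∈ openTriangle (p (e 0)) (p (e 1)) (p (e 2))).card := by
      rw [← Finset.card_map (Function.Embedding.subtype _)]
      congr 1
      ext j
      simp only [Finset.mem_filter, Finset.mem_univ, true_and, Finset.mem_map,
        Function.Embedding.subtype_apply]
      constructor
      · intro hj
        refine ⟨⟨j, ?_⟩, hj, rfl⟩
        rintro ⟨k, rfl⟩
        have hv := vertices_notMem_openTriangle (p (e 0)) (p (e 1)) (p (e 2))
        fin_cases k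
        · exact hv.1 hj
        · exact hv.2.1 hj
        · exact hv.2.2 hj
      · rintro ⟨j', hj', rfl⟩
        exact hj'
    rw [hc]
  have hfib : ∀ᵐ x ∂(Measure.pi fun _ : Fin 3 => squareMeasure),
      ((Measure.pi fun _ : C => squareMeasure) (Prod.mk x ⁻¹' S)).toReal
        = (binomialCdf (n - 3) s).eval (|orient (x 0) (x 1) (x 2)| / 2) := by
    filter_upwards [ae_orient_ne_zero, ae_pi_mem_unitSquare] with x hx0 hx
    have e1 : Prod.mk x ⁻¹' S = {y : C → Plane |
        (Finset.univ.filter fun j => y j ∈ openTriangle (x 0) (x 1) (x 2)).card ≤ s} := by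
      ext y
      simp [S, hx0]
    have hm : MeasurableSet (openTriangle (x 0) (x 1) (x 2)) :=
      measurableSet_mem_openTriangle measurable_const measurable_const measurable_const
        measurable_id
    have h1 := measureReal_pi_card_le (ι := C) squareMeasure hm s
    rw [e1]
    rw [Measure.real, hcard, Measure.real, squareMeasure_openTriangle hx,
      ENNReal.toReal_ofReal (by positivity)] at h1
    convert h1 using 1
  rw [Measure.real, hpre, (measurePreserving_split_embedding squareMeasure e).measure_preimage
    hS.nullMeasurableSet, Measure.prod_apply hS, ← integral_toReal
      (measurable_measure_prodMk_left hS).aemeasurable (ae_of_all _ fun _ => measure_lt_top _ _),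
    integral_congr_ae hfib, areaLaw, integral_map measurable_area.aemeasurable]
  exact (by fun_prop : Continuous fun a => (binomialCdf (n - 3) s).eval a).aestronglyMeasurable

/-! ### Counting triangles -/

section Counting

variable {n : ℕ} {p : Fin n → Plane}

/-- The configurations in which the points with indices in `I` are affinely independent, with at
most `s` of the points in the interior of their convex hull. -/
def fewInsideHull (s : ℕ) (I : Finset (Fin n)) : Set (Fin n → Plane) :=
  {p | AffineIndependent ℝ (fun i : I => p i) ∧ interiorCount (pointSet p) (p '' I) ≤ s}

open scoped Classical in
lemma interiorCount_pointSet (hp : Function.Injective p) (T : Set Plane) :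
    interiorCount (pointSet p) T
      = (Finset.univ.filter fun j => p j ∈ interior (convexHull ℝ T)).card := by
  rw [interiorCount, ← Finset.card_map ⟨p, hp⟩, ← Set.ncard_coe_finset]
  congr 1
  ext x
  simp only [pointSet, Set.mem_inter_iff, Finset.coe_image, Finset.coe_univ, Set.image_univ,
    Set.mem_range, Finset.coe_map, Function.Embedding.coeFn_mk, Set.mem_image, Finset.mem_coe,
    Finset.mem_filter, Finset.mem_univ, true_and]
  constructor
  · rintro ⟨hx, j, rfl⟩
    exact ⟨j, hx, rfl⟩
  · rintro ⟨j, hj, rfl⟩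
    exact ⟨hj, j, rfl⟩

lemma mem_fewInsideHull_iff (hp : Function.Injective p) {s : ℕ} {I : Finset (Fin n)}
    (h : I.card = 3) : p ∈ fewInsideHull s I ↔ p ∈ fewInside s (I.orderEmbOfFin h).toEmbedding := by
  classical
  set e := (I.orderEmbOfFin h).toEmbedding
  have hrange : Set.range e = I := I.range_orderEmbOfFin h
  have h1 : AffineIndependent ℝ (fun i : I => p i) ↔ AffineIndependent ℝ (p ∘ e) := by
    rw [← affineIndependent_equiv (I.orderIsoOfFin h).toEquiv]
    rfl
  have h2 : p '' I = Set.range (p ∘ e) := by rw [Set.range_comp, hrange]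
  simp only [fewInsideHull, fewInside, Set.mem_ofPred_eq]
  rw [h1]
  have h3 := affineIndependent_iff_orient_ne_zero (p ∘ e)
  simp only [Function.comp_apply] at h3
  rw [← h3]
  refine and_congr_right fun ha => ?_
  have h4 := interior_convexHull_eq_openTriangle ha
  simp only [Function.comp_apply] at h4
  rw [interiorCount_pointSet hp, h2, h4]

open scoped Classical in
lemma numMonoTrianglesLE_eq {c : ℕ} (s : ℕ) (p : Fin n → Plane) (φ : Fin n → Fin c) :
    numMonoTrianglesLE s p φ = (((Finset.univ : Finset (Fin n)).powersetCard 3).filter fun I =>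
      p ∈ fewInsideHull s I ∧ ∀ i ∈ I, ∀ j ∈ I, φ i = φ j).card := by
  simp only [numMonoTrianglesLE, fewInsideHull, Set.mem_ofPred_eq, and_assoc]

open scoped Classical in
lemma numTrianglesLE_pointSet (s : ℕ) (hp : Function.Injective p) :
    numTrianglesLE s (pointSet p) = (((Finset.univ : Finset (Fin n)).powersetCard 3).filter fun I =>
      p ∈ fewInsideHull s I).card := by
  let f : Fin n ↪ Plane := ⟨p, hp⟩
  have h1 : pointSet p = Finset.univ.map f := by
    rw [pointSet, Finset.map_eq_image]; rfl
  rw [numTrianglesLE, trianglesOf, Finset.filter_filter]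
  conv_lhs => rw [h1, Finset.powersetCard_map, Finset.filter_map, Finset.card_map]
  congr 1
  refine Finset.filter_congr fun I _ => ?_
  simp only [Function.comp_apply, fewInsideHull, Set.mem_ofPred_eq, RelEmbedding.coe_toEmbedding,
    Finset.mapEmbedding_apply, ← h1, Finset.coe_map]
  refine and_congr ?_ Iff.rfl
  have hb : Function.Bijective fun i : I =>
      (⟨f i, Finset.mem_map_of_mem f i.2⟩ : {x // x ∈ I.map f}) := by
    refine ⟨fun i j hij => Subtype.ext (hp (congrArg Subtype.val hij)), fun x => ?_⟩
    obtain ⟨i, hi, hix⟩ := Finset.mem_map.1 x.2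
    exact ⟨⟨i, hi⟩, Subtype.ext hix⟩
  rw [← affineIndependent_equiv (Equiv.ofBijective _ hb)]
  rfl

lemma numTrianglesLE_succ (s : ℕ) (A : Finset Plane) :
    numTrianglesLE (s + 1) A = numTrianglesLE s A + numTrianglesEq (s + 1) A := by
  classical
  rw [numTrianglesLE, numTrianglesLE, numTrianglesEq, ← Finset.card_union_of_disjoint,
    ← Finset.filter_or]
  · congr 1
    refine Finset.filter_congr fun T _ => ?_
    omega
  · rw [Finset.disjoint_filter]
    intro T _ h1 h2
    omega

lemma numTrianglesEq_zero (A : Finset Plane) : numTrianglesEq 0 A = numTrianglesLE 0 A := by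
  simp [numTrianglesEq, numTrianglesLE]

end Counting

/-- The probability that a given triple of `n` uniform points spans a triangle with at most `s`
points in its interior. For `n < 3` there is no such triple and the truncated `n - 3` is harmless,
the value being used only with the factor `C(n, 3) = 0`. -/
noncomputable def fewInsideProb (n s : ℕ) : ℝ := ∫ a, (binomialCdf (n - 3) s).eval a ∂areaLaw

lemma tendsto_choose_mul_fewInsideProb (s : ℕ) :
    Tendsto (fun n : ℕ => (n.choose 3 : ℝ) * fewInsideProb n s / (n : ℝ) ^ 2) atTop
      (𝓝 (2 * ((s : ℝ) + 1))) := by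
  have h1 := tendsto_mul_integral_binomialCdf ae_areaLaw_mem_Icc tendsto_areaLaw_Iio_div s
  rw [← tendsto_add_atTop_iff_nat 4]
  rw [← tendsto_add_atTop_iff_nat 1] at h1
  have hd : ∀ b : ℝ, Tendsto (fun n : ℕ => 1 / ((n : ℝ) + b)) atTop (𝓝 0) := fun b =>
    tendsto_const_nhds.div_atTop
      (tendsto_atTop_add_const_right _ _ tendsto_natCast_atTop_atTop)
  have h2 : Tendsto (fun n : ℕ => (1 / 6 : ℝ) * (1 - 1 / ((n : ℝ) + 4)) * (1 + 1 / ((n : ℝ) + 1)))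
      atTop (𝓝 (1 / 6 * (1 - 0) * (1 + 0))) :=
    ((tendsto_const_nhds.sub (hd 4)).const_mul _).mul
      (tendsto_const_nhds.add (hd 1))
  have h3 := h2.mul h1
  have e : 1 / 6 * (1 - 0) * (1 + 0) * (12 * ((s : ℝ) + 1)) = 2 * ((s : ℝ) + 1) := by ring
  rw [e] at h3
  refine h3.congr fun n => ?_
  have h4 : (((n + 4).choose 3 : ℕ) : ℝ) = ((n : ℝ) + 4) * (n + 3) * (n + 2) / 6 := by
    have := Nat.cast_choose_eq_ascPochhammer_div ℝ (n + 4) 3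
    rw [this]
    simp [ascPochhammer_succ_right, Nat.factorial]
    ring
  rw [h4, fewInsideProb, show n + 4 - 3 = n + 1 by omega]
  push_cast
  field_simp
  ring

section Sample

variable {Ω : Type*} [MeasurableSpace Ω] {μ : Measure Ω} {n : ℕ}
  {U : Fin n → Ω → Plane}

lemma IsUniformSample.aemeasurable (hU : IsUniformSample μ U) (i : Fin n) :
    AEMeasurable (U i) μ :=
  (hU.2 i).aemeasurable (by simp [volume_unitSquare]) (by simp [volume_unitSquare])

lemma IsUniformSample.aemeasurable_pi (hU : IsUniformSample μ U) :
    AEMeasurable (fun ω i => U i ω) μ :=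
  aemeasurable_pi_lambda _ hU.aemeasurable

lemma IsUniformSample.nullMeasurableSet_fewInside (hU : IsUniformSample μ U) (s : ℕ)
    (e : Fin 3 ↪ Fin n) : NullMeasurableSet {ω | (fun i => U i ω) ∈ fewInside s e} μ :=
  hU.aemeasurable_pi.nullMeasurableSet_preimage (measurableSet_fewInside s e)

variable [IsProbabilityMeasure μ]

lemma IsUniformSample.map_eq (hU : IsUniformSample μ U) :
    μ.map (fun ω i => U i ω) = Measure.pi fun _ => squareMeasure := by
  rw [(iIndepFun_iff_map_fun_eq_pi_map hU.aemeasurable).1 hU.1]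
  congr 1
  funext i
  rw [(hU.2 i : μ.map (U i) = _), ProbabilityTheory.cond, volume_unitSquare, squareMeasure]
  simp

lemma ae_injective_pi_squareMeasure :
    ∀ᵐ p ∂(Measure.pi fun _ : Fin n => squareMeasure), Function.Injective p := by
  have h : ∀ i j : Fin n, i ≠ j →
      ∀ᵐ p ∂(Measure.pi fun _ : Fin n => squareMeasure), p i 0 ≠ p j 0 := by
    intro i j hij
    have hind : iIndepFun (fun i (p : Fin n → Plane) => p i)
        (Measure.pi fun _ : Fin n => squareMeasure) :=
      iIndepFun_pi (X := fun _ (x : Plane) => x) fun _ => aemeasurable_id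
    have hm : ∀ i, (Measure.pi fun _ : Fin n => squareMeasure).map (fun p => p i)
        = squareMeasure := fun i => (measurePreserving_eval _ i).map_eq
    have hmap := (indepFun_iff_map_prod_eq_prod_map_map (measurable_pi_apply i).aemeasurable
      (measurable_pi_apply j).aemeasurable).1 (hind.indepFun hij)
    rw [hm, hm] at hmap
    have hq := ae_coord_zero_ne_prod
    rw [← hmap] at hq
    exact ae_of_ae_map (p := fun z : Plane × Plane => z.1 0 ≠ z.2 0) (by fun_prop) hq
  have h' : ∀ᵐ p ∂(Measure.pi fun _ : Fin n => squareMeasure), ∀ i j, i ≠ j → p i 0 ≠ p j 0 := by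
    simp only [ae_all_iff]
    exact h
  filter_upwards [h'] with p hp i j hij
  by_contra hne
  exact hp i j hne (by rw [hij])

lemma IsUniformSample.ae_injective (hU : IsUniformSample μ U) :
    ∀ᵐ ω ∂μ, Function.Injective fun i => U i ω := by
  have h : ∀ᵐ p ∂(μ.map fun ω i => U i ω), Function.Injective p := by
    rw [hU.map_eq]; exact ae_injective_pi_squareMeasure
  exact ae_of_ae_map hU.aemeasurable_pi h

lemma IsUniformSample.measureReal_fewInside (hU : IsUniformSample μ U) (s : ℕ)
    (e : Fin 3 ↪ Fin n) : μ.real {ω | (fun i => U i ω) ∈ fewInside s e} = fewInsideProb n s := by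
  rw [fewInsideProb, ← _root_.measureReal_fewInside s e, ← hU.map_eq,
    map_measureReal_apply_of_aemeasurable hU.aemeasurable_pi (measurableSet_fewInside s e)]
  rfl

lemma IsUniformSample.fewInsideHull_ae_eq (hU : IsUniformSample μ U) (s : ℕ)
    {I : Finset (Fin n)} (h : I.card = 3) :
    ({ω | (fun i => U i ω) ∈ fewInsideHull s I} : Set Ω)
      =ᵐ[μ] ({ω | (fun i => U i ω) ∈ fewInside s (I.orderEmbOfFin h).toEmbedding} : Set Ω) := by
  rw [eventuallyEq_set]
  filter_upwards [hU.ae_injective] with ω hω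
  exact mem_fewInsideHull_iff hω h

open scoped Classical in
/-- Linearity of expectation for the number of the members of a finite family of events that
occur. -/
lemma integral_card_filter {κ : Type*} (F : Finset κ) {P : κ → Ω → Prop}
    (hP : ∀ k ∈ F, NullMeasurableSet {ω | P k ω} μ) {q : ℝ}
    (hq : ∀ k ∈ F, μ.real {ω | P k ω} = q) :
    Integrable (fun ω => ((F.filter fun k => P k ω).card : ℝ)) μ ∧
      ∫ ω, ((F.filter fun k => P k ω).card : ℝ) ∂μ = F.card * q := by
  have h1 : ∀ ω, ((F.filter fun k => P k ω).card : ℝ)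
      = ∑ k ∈ F, {ω | P k ω}.indicator (fun _ => (1 : ℝ)) ω := fun ω => by
    rw [Finset.card_filter]
    push_cast
    simp [Set.indicator_apply]
  have h2 : ∀ k ∈ F, Integrable ({ω | P k ω}.indicator fun _ => (1 : ℝ)) μ := fun k hk =>
    (integrable_const _).indicator₀ (hP k hk)
  simp_rw [h1]
  refine ⟨integrable_finsetSum _ h2, ?_⟩
  rw [integral_finsetSum _ h2, Finset.sum_congr rfl fun k hk => ?_, Finset.sum_const, nsmul_eq_mul]
  rw [integral_indicator₀ (hP k hk), setIntegral_const, smul_eq_mul, mul_one, hq k hk]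

lemma IsUniformSample.integral_numTrianglesLE (hU : IsUniformSample μ U) (s : ℕ) :
    Integrable (fun ω => (numTrianglesLE s (pointSet fun i => U i ω) : ℝ)) μ ∧
      ∫ ω, (numTrianglesLE s (pointSet fun i => U i ω) : ℝ) ∂μ
        = n.choose 3 * fewInsideProb n s := by
  classical
  have h := integral_card_filter (μ := μ) ((Finset.univ : Finset (Fin n)).powersetCard 3)
    (P := fun I ω => (fun i => U i ω) ∈ fewInsideHull s I) (q := fewInsideProb n s)
    (fun I hI => by
      have h3 := (Finset.mem_powersetCard.1 hI).2
      exact (hU.nullMeasurableSet_fewInside s _).congr (hU.fewInsideHull_ae_eq s h3).symm)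
    (fun I hI => by
      have h3 := (Finset.mem_powersetCard.1 hI).2
      rw [measureReal_congr (hU.fewInsideHull_ae_eq s h3), hU.measureReal_fewInside])
  rw [Finset.card_powersetCard, Finset.card_univ, Fintype.card_fin] at h
  have hae : (fun ω => (numTrianglesLE s (pointSet fun i => U i ω) : ℝ)) =ᵐ[μ] fun ω =>
      ((((Finset.univ : Finset (Fin n)).powersetCard 3).filter fun I =>
        (fun i => U i ω) ∈ fewInsideHull s I).card : ℝ) := by
    filter_upwards [hU.ae_injective] with ω hω
    rw [numTrianglesLE_pointSet s hω]
  exact ⟨h.1.congr hae.symm, (integral_congr_ae hae).trans h.2⟩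

/-- Three given points have the same colour with probability `c⁻²`. -/
lemma IsUniformColoring.measureReal_mono {c : ℕ} (hc : 1 ≤ c) {φ : Fin n → Ω → Fin c}
    (hφ : IsUniformColoring μ U φ) {I : Finset (Fin n)} (hI : I.card = 3) :
    μ.real {ω | ∀ i ∈ I, ∀ j ∈ I, φ i ω = φ j ω} = 1 / (c : ℝ) ^ 2 := by
  obtain ⟨hind, hmeas, hunif, -⟩ := hφ
  have hne : I.Nonempty := Finset.card_pos.1 (by omega)
  obtain ⟨i₀, hi₀⟩ := hne
  have h1 : {ω | ∀ i ∈ I, ∀ j ∈ I, φ i ω = φ j ω}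
      = ⋃ a ∈ (Finset.univ : Finset (Fin c)), ⋂ i ∈ I, φ i ⁻¹' {a} := by
    ext ω
    simp only [Set.mem_ofPred_eq, Set.mem_iUnion, Finset.mem_univ, exists_prop, true_and,
      Set.mem_iInter, Set.mem_preimage, Set.mem_singleton_iff]
    exact ⟨fun h => ⟨φ i₀ ω, fun i hi => h i hi i₀ hi₀⟩,
      fun ⟨a, ha⟩ i hi j hj => (ha i hi).trans (ha j hj).symm⟩
  have h2 : ∀ a : Fin c, μ.real (⋂ i ∈ I, φ i ⁻¹' {a}) = ((c : ℝ)⁻¹) ^ 3 := by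
    intro a
    rw [Measure.real, hind.measure_inter_preimage_eq_mul I (fun i _ => measurableSet_singleton a)]
    have : ∀ i ∈ I, μ (φ i ⁻¹' {a}) = (c : ℝ≥0∞)⁻¹ := fun i _ => hunif i a
    rw [Finset.prod_congr rfl this, Finset.prod_const, hI]
    simp
  rw [h1, measureReal_biUnion_finset₀, Finset.sum_congr rfl fun a _ => h2 a]
  · rw [Finset.sum_const, Finset.card_univ, Fintype.card_fin, nsmul_eq_mul]
    have : (c : ℝ) ≠ 0 := by positivity
    field_simp
  · intro a _ b _ hab
    refine Disjoint.aedisjoint ?_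
    rw [Set.disjoint_left]
    intro ω ha hb
    simp only [Set.mem_iInter, Set.mem_preimage, Set.mem_singleton_iff] at ha hb
    exact hab ((ha i₀ hi₀).symm.trans (hb i₀ hi₀))
  · intro a _
    exact NullMeasurableSet.biInter I.countable_toSet fun i _ =>
      (hmeas i).nullMeasurableSet_preimage (measurableSet_singleton a)

lemma integral_numMonoTrianglesLE (hU : IsUniformSample μ U) (s : ℕ) {c : ℕ} (hc : 1 ≤ c)
    {φ : Fin n → Ω → Fin c} (hφ : IsUniformColoring μ U φ) :
    Integrable (fun ω => (numMonoTrianglesLE s (fun i => U i ω) (fun i => φ i ω) : ℝ)) μ ∧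
      ∫ ω, (numMonoTrianglesLE s (fun i => U i ω) (fun i => φ i ω) : ℝ) ∂μ
        = n.choose 3 * (fewInsideProb n s * (1 / (c : ℝ) ^ 2)) := by
  classical
  have hφm : AEMeasurable (fun ω i => φ i ω) μ := aemeasurable_pi_lambda _ hφ.2.1
  have hM : ∀ I : Finset (Fin n),
      MeasurableSet {f : Fin n → Fin c | ∀ i ∈ I, ∀ j ∈ I, f i = f j} := fun I =>
    (Set.toFinite _).measurableSet
  have hae : ∀ {I : Finset (Fin n)} (h3 : I.card = 3),
      ({ω | (fun i => U i ω) ∈ fewInsideHull s I ∧ ∀ i ∈ I, ∀ j ∈ I, φ i ω = φ j ω} : Set Ω)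
        =ᵐ[μ] ((fun ω i => U i ω) ⁻¹' fewInside s (I.orderEmbOfFin h3).toEmbedding ∩
          (fun ω i => φ i ω) ⁻¹' {f | ∀ i ∈ I, ∀ j ∈ I, f i = f j} : Set Ω) := fun {I} h3 =>
    (hU.fewInsideHull_ae_eq s h3).inter (ae_eq_refl _)
  have h := integral_card_filter (μ := μ) ((Finset.univ : Finset (Fin n)).powersetCard 3)
    (P := fun I ω => (fun i => U i ω) ∈ fewInsideHull s I ∧ ∀ i ∈ I, ∀ j ∈ I, φ i ω = φ j ω)
    (q := fewInsideProb n s * (1 / (c : ℝ) ^ 2))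
    (fun I hI => by
      have h3 := (Finset.mem_powersetCard.1 hI).2
      exact ((hU.nullMeasurableSet_fewInside s _).inter
        (hφm.nullMeasurableSet_preimage (hM I))).congr (hae h3).symm)
    (fun I hI => by
      have h3 := (Finset.mem_powersetCard.1 hI).2
      rw [measureReal_congr (hae h3), Measure.real, hφ.2.2.2.measure_inter_preimage_eq_mul _ _
        (measurableSet_fewInside s _) (hM I), ENNReal.toReal_mul,
        ← hU.measureReal_fewInside s (I.orderEmbOfFin h3).toEmbedding, ← hφ.measureReal_mono hc h3]
      rfl)
  rw [Finset.card_powersetCard, Finset.card_univ, Fintype.card_fin] at h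
  simp_rw [numMonoTrianglesLE_eq]
  convert h

end Sample

theorem theorem3 (Ω : ℕ → Type*) [∀ n, MeasurableSpace (Ω n)] (μ : ∀ n, Measure (Ω n))
    [∀ n, IsProbabilityMeasure (μ n)] (U : ∀ n, Fin n → Ω n → Plane)
    (hU : ∀ n, IsUniformSample (μ n) (U n)) (s : ℕ) :
    ((∀ n, Integrable (fun ω => (numTrianglesEq s (pointSet fun i => U n i ω) : ℝ)) (μ n)) ∧
      Tendsto (fun n : ℕ =>
        (∫ ω, (numTrianglesEq s (pointSet fun i => U n i ω) : ℝ) ∂(μ n)) / (n : ℝ) ^ 2)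
        atTop (𝓝 2)) ∧
    ((∀ n, Integrable (fun ω => (numTrianglesLE s (pointSet fun i => U n i ω) : ℝ)) (μ n)) ∧
      Tendsto (fun n : ℕ =>
        (∫ ω, (numTrianglesLE s (pointSet fun i => U n i ω) : ℝ) ∂(μ n)) / (n : ℝ) ^ 2)
        atTop (𝓝 (2 * ((s : ℝ) + 1)))) ∧
    (∀ (c : ℕ) (_ : 1 ≤ c) (φ : ∀ n, Fin n → Ω n → Fin c),
      (∀ n, IsUniformColoring (μ n) (U n) (φ n)) →
      (∀ n, Integrable (fun ω =>
        (numMonoTrianglesLE s (fun i => U n i ω) (fun i => φ n i ω) : ℝ)) (μ n)) ∧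
      (fun n : ℕ =>
        ∫ ω, (numMonoTrianglesLE s (fun i => U n i ω) (fun i => φ n i ω) : ℝ) ∂(μ n))
        ~[atTop] fun n : ℕ => 2 * ((s : ℝ) + 1) / (c : ℝ) ^ 2 * (n : ℝ) ^ 2) := by
  have hLE : ∀ s : ℕ, Tendsto (fun n : ℕ =>
      (∫ ω, (numTrianglesLE s (pointSet fun i => U n i ω) : ℝ) ∂(μ n)) / (n : ℝ) ^ 2)
      atTop (𝓝 (2 * ((s : ℝ) + 1))) := fun s =>
    (tendsto_choose_mul_fewInsideProb s).congr fun n => by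
      rw [((hU n).integral_numTrianglesLE s).2]
  refine ⟨?_, ⟨fun n => ((hU n).integral_numTrianglesLE s).1, hLE s⟩, ?_⟩
  · cases s with
    | zero =>
      simp_rw [numTrianglesEq_zero]
      exact ⟨fun n => ((hU n).integral_numTrianglesLE 0).1, by simpa using hLE 0⟩
    | succ s =>
      have e : ∀ A, (numTrianglesEq (s + 1) A : ℝ)
          = numTrianglesLE (s + 1) A - numTrianglesLE s A := fun A => by
        rw [numTrianglesLE_succ]; push_cast; ring
      have hi := fun n => ((hU n).integral_numTrianglesLE (s + 1)).1
      have hi' := fun n => ((hU n).integral_numTrianglesLE s).1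
      simp_rw [e]
      refine ⟨fun n => (hi n).sub (hi' n), ?_⟩
      have h := (hLE (s + 1)).sub (hLE s)
      have e2 : 2 * (((s + 1 : ℕ) : ℝ) + 1) - 2 * ((s : ℝ) + 1) = 2 := by push_cast; ring
      rw [e2] at h
      refine h.congr fun n => ?_
      rw [integral_sub (hi n) (hi' n), sub_div]
  · intro c hc φ hφ
    refine ⟨fun n => (integral_numMonoTrianglesLE (hU n) s hc (hφ n)).1, ?_⟩
    have hc0 : (c : ℝ) ≠ 0 := by positivity
    have hs0 : 2 * ((s : ℝ) + 1) ≠ 0 := by positivity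
    rw [isEquivalent_iff_tendsto_one]
    · have h := (tendsto_choose_mul_fewInsideProb s).div_const (2 * ((s : ℝ) + 1))
      rw [div_self hs0] at h
      refine h.congr fun n => ?_
      rw [Pi.div_apply, (integral_numMonoTrianglesLE (hU n) s hc (hφ n)).2]
      field_simp
    · filter_upwards [eventually_gt_atTop 0] with n hn
      have : (n : ℝ) ≠ 0 := by positivity
      positivity
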